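/- A closed $n$-manifold is a compact Hausdorff smooth ($C^\infty$) manifold of dimension $n$ without boundary; the empty manifold is allowed. Two closed $n$-manifolds $M,N$ are cobordant if there is a compact Hausdorff smooth $(n+1)$-manifold with boundary $W$ and a smooth embedding $M\sqcup N\to W$ whose image is $\partial W$ (that is, $\partial W$ is diffeomorphic to the disjoint union $M\sqcup N$); $M$ is nullbordant if it is cobordant with the empty manifold. Theorem (Every one-dimensional manifold is nullbordant). 1. Every closed $1$-manifold is a finite (possibly empty) disjoint union of circles: it is partitioned into finitely many open subsets, each diffeomorphic to the unit circle $S^1\subset\mathbb{R}^2$. 2. Every circle bounds a disc: the closed unit disc $D^2\subset\mathbb{R}^2$ has a structure of smooth manifold with boundary for which the inclusion $D^2\to\mathbb{R}^2$ is a smooth embedding, and for every closed $1$-manifold $C$ and every diffeomorphism $\Phi\colon C\to S^1$ the composite $C\xrightarrow{\Phi}S^1\hookrightarrow D^2$ is a smooth embedding with image $\partial D^2$. 3. Every closed $1$-manifold is nullbordant. 4. Cobordism is an equivalence relation on closed $1$-manifolds, and there is exactly one cobordism class of closed $1$-manifolds. -/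

import Mathlib

open scoped Manifold ContDiff

universe u

/-- A closed smooth `n`-manifold: a compact Hausdorff space with a smooth atlas modelled on `ℝⁿ`.
The model has no boundary, and second countability follows from compactness. The empty manifold is
allowed. -/
structure ClosedManifold (n : ℕ) : Type (u + 1) where
  carrier : Type u
  [topologicalSpace : TopologicalSpace carrier]
  [t2Space : T2Space carrier]
  [compactSpace : CompactSpace carrier]
  [chartedSpace : ChartedSpace (EuclideanSpace ℝ (Fin n)) carrier]
  [isManifold : IsManifold (𝓡 n) ∞ carrier]

namespace ClosedManifold

instance (n : ℕ) : CoeSort (ClosedManifold.{u} n) (Type u) := ⟨carrier⟩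

attribute [instance] topologicalSpace t2Space compactSpace chartedSpace isManifold

/-- The empty set as a closed `n`-manifold. -/
def empty (n : ℕ) : ClosedManifold.{u} n :=
  letI : ChartedSpace (EuclideanSpace ℝ (Fin n)) PEmpty.{u + 1} := ChartedSpace.empty _ _
  { carrier := PEmpty.{u + 1} }

end ClosedManifold

/-- `ι` identifies the `n`-manifold `M` with the boundary of the `(n+1)`-manifold with boundary
`W`: it is a smooth embedding whose image is `∂W`. -/
def IsBoundaryParametrization (n : ℕ) {M W : Type*}
    [TopologicalSpace M] [ChartedSpace (EuclideanSpace ℝ (Fin n)) M]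
    [TopologicalSpace W] [ChartedSpace (EuclideanHalfSpace (n + 1)) W] (ι : M → W) : Prop :=
  Manifold.IsSmoothEmbedding (𝓡 n) (𝓡∂ (n + 1)) ∞ ι ∧
    Set.range ι = (𝓡∂ (n + 1)).boundary W

namespace ClosedManifold

/-- `M` and `N` are cobordant: there is a compact smooth `(n+1)`-manifold with boundary whose
boundary is (diffeomorphic to) the disjoint union of `M` and `N`. -/
def Cobordant {n : ℕ} (M N : ClosedManifold.{u} n) : Prop :=
  ∃ (W : Type u) (_ : TopologicalSpace W) (_ : ChartedSpace (EuclideanHalfSpace (n + 1)) W),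
    T2Space W ∧ CompactSpace W ∧ IsManifold (𝓡∂ (n + 1)) ∞ W ∧
      ∃ ι : M ⊕ N → W, IsBoundaryParametrization n ι

/-- `M` is nullbordant: it is cobordant with the empty manifold. -/
def Nullbordant {n : ℕ} (M : ClosedManifold.{u} n) : Prop :=
  Cobordant M (empty n)

end ClosedManifold

/-- The unit circle in the plane, with Mathlib's smooth structure on spheres. -/
abbrev UnitCircle : Type := Metric.sphere (0 : EuclideanSpace ℝ (Fin 2)) 1

/-- The closed unit disc in the plane. -/
abbrev UnitDisc : Type := Metric.closedBall (0 : EuclideanSpace ℝ (Fin 2)) 1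

/-- The inclusion of the unit circle in the closed unit disc. -/
def circleToDisc : UnitCircle → UnitDisc := Set.inclusion Metric.sphere_subset_closedBall

/-- `M` is a finite disjoint union of circles: it is partitioned into finitely many open subsets,
each diffeomorphic to the circle. -/
def ClosedManifold.IsFiniteDisjointUnionOfCircles (M : ClosedManifold.{u} 1) : Prop :=
  ∃ (k : ℕ) (U : Fin k → TopologicalSpace.Opens M),
    Pairwise (fun i j => Disjoint (U i) (U j)) ∧ (⨆ i, U i) = ⊤ ∧
      ∀ i, Nonempty (Diffeomorph (𝓡 1) (𝓡 1) (U i) UnitCircle ∞)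

/-- Every circle bounds a disc: the closed unit disc is a smooth manifold with boundary, smoothly
embedded in the plane (this determines its smooth structure), and every manifold `C` diffeomorphic
to the unit circle is identified with the boundary of the disc by the diffeomorphism followed by
the inclusion of the unit circle. -/
def EveryCircleBoundsDisc : Prop :=
  ∃ _ : ChartedSpace (EuclideanHalfSpace 2) UnitDisc,
    IsManifold (𝓡∂ 2) ∞ UnitDisc ∧
    Manifold.IsSmoothEmbedding (𝓡∂ 2) (𝓡 2) ∞
      (Subtype.val : UnitDisc → EuclideanSpace ℝ (Fin 2)) ∧
    ∀ (C : ClosedManifold.{u} 1) (Φ : Diffeomorph (𝓡 1) (𝓡 1) C UnitCircle ∞),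
      IsBoundaryParametrization 1 (circleToDisc ∘ Φ)

/-! Embed a closed 1-manifold M in a Euclidean space and measure arc length there. The arc-length
charts have transition maps x ↦ c ± x (`isometricAtlas_unitSpeedCharts`), so unit-speed curves,
called geodesics here, are affine in these charts. Compactness gives coordinate intervals of a
uniform size, so geodesics extend to all times (`IsometricAtlas.exists_isGeodesic`). Their ranges
are open and pairwise equal or disjoint, hence closed. A geodesic cannot be injective, since ℝ is
not compact, and it cannot turn back, so its fibres are exactly the cosets of some Tℤ with T > 0
(`IsGeodesic.exists_period`).

The circle is itself a connected closed 1-manifold, so the same argument presents it as a quotient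
of ℝ by translations. Quotients by local diffeomorphisms with the same fibres are diffeomorphic
(`nonempty_diffeomorph_of_isLocalDiffeomorph`), so every geodesic range is a circle, and finitely
many of them cover M.

The disc gets polar collar charts along its boundary and a translation as chart in its interior;
finitely many copies of it bound finitely many circles. Finally M ⊔ N is again a closed 1-manifold,
hence a boundary. So any two closed 1-manifolds are cobordant
(`ClosedManifold.cobordant_of_dim_one`), which gives nullbordance, the equivalence relation and the
single class at once. -/

open Set Filter Topology

/-! ### Geodesics of an isometric atlas: uniqueness, completeness, periodicity -/

section Geodesics

variable {M : Type*} [TopologicalSpace M] {A : Set (OpenPartialHomeomorph M ℝ)}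

/-- A family of real charts covering `M`, whose transition maps are locally of the form
`x ↦ c ± x`. -/
structure IsometricAtlas (A : Set (OpenPartialHomeomorph M ℝ)) : Prop where
  exists_mem_source : ∀ x, ∃ σ ∈ A, x ∈ σ.source
  compatible : ∀ σ ∈ A, ∀ τ ∈ A, ∀ x ∈ σ.source, x ∈ τ.source →
    ∃ ε : ℝ, (ε = 1 ∨ ε = -1) ∧ ∀ᶠ y in 𝓝 x, τ y = τ x + ε * (σ y - σ x)

/-- Near `t`, the curve `γ` moves at unit speed in some chart of the family `A`. -/
def IsGeodesicAt (A : Set (OpenPartialHomeomorph M ℝ)) (γ : ℝ → M) (t : ℝ) : Prop :=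
  ContinuousAt γ t ∧ ∃ σ ∈ A, γ t ∈ σ.source ∧
    ∃ ε : ℝ, (ε = 1 ∨ ε = -1) ∧ ∀ᶠ s in 𝓝 t, σ (γ s) = σ (γ t) + ε * (s - t)

namespace IsGeodesicAt

variable {γ η : ℝ → M} {t : ℝ}

/-- Since transition maps have slope ±1, unit speed in one chart is unit speed in every chart of `A`
around the point. -/
theorem exists_eventually_eq (hA : IsometricAtlas A) (h : IsGeodesicAt A γ t)
    {τ : OpenPartialHomeomorph M ℝ} (hτ : τ ∈ A) (ht : γ t ∈ τ.source) :
    ∃ ε : ℝ, (ε = 1 ∨ ε = -1) ∧ ∀ᶠ s in 𝓝 t, γ s ∈ τ.source ∧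
      τ (γ s) = τ (γ t) + ε * (s - t) ∧ γ s = τ.symm (τ (γ t) + ε * (s - t)) := by
  obtain ⟨hc, σ, hσ, hσt, ε, hε, h⟩ := h
  obtain ⟨ε', hε', h'⟩ := hA.compatible σ hσ τ hτ _ hσt ht
  refine ⟨ε' * ε, ?_, ?_⟩
  · rcases hε with rfl | rfl <;> rcases hε' with rfl | rfl <;> norm_num
  · filter_upwards [h, hc.eventually h', hc.eventually (τ.open_source.mem_nhds ht)] with s h1 h2 h3
    have : τ (γ s) = τ (γ t) + ε' * ε * (s - t) := by rw [h2, h1]; ring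
    exact ⟨h3, this, by rw [← this, τ.left_inv h3]⟩

theorem congr (h : IsGeodesicAt A γ t) (he : γ =ᶠ[𝓝 t] η) : IsGeodesicAt A η t := by
  obtain ⟨hc, σ, hσ, hσt, ε, hε, h⟩ := h
  have ht := he.self_of_nhds
  refine ⟨hc.congr he, σ, hσ, ht ▸ hσt, ε, hε, ?_⟩
  filter_upwards [h, he] with s h1 h2
  rw [← h2, ← ht, h1]

theorem comp_affine {δ c : ℝ} (hδ : δ = 1 ∨ δ = -1) (h : IsGeodesicAt A γ (δ * t + c)) :
    IsGeodesicAt A (fun s => γ (δ * s + c)) t := by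
  obtain ⟨hc, σ, hσ, hσt, ε, hε, h⟩ := h
  have hcont : ContinuousAt (fun s : ℝ => δ * s + c) t := by fun_prop
  refine ⟨ContinuousAt.comp (f := fun s : ℝ => δ * s + c) hc hcont, σ, hσ, hσt, ε * δ, ?_, ?_⟩
  · rcases hε with rfl | rfl <;> rcases hδ with rfl | rfl <;> norm_num
  · filter_upwards [hcont.eventually h] with s h1
    rw [h1]; ring

end IsGeodesicAt

theorem isGeodesicAt_symm_affine {σ : OpenPartialHomeomorph M ℝ} (hσ : σ ∈ A) {ε c t : ℝ}
    (hε : ε = 1 ∨ ε = -1) (ht : c + ε * t ∈ σ.target) :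
    IsGeodesicAt A (fun s => σ.symm (c + ε * s)) t := by
  have hcont : ContinuousAt (fun s : ℝ => c + ε * s) t := by fun_prop
  refine ⟨ContinuousAt.comp (f := fun s : ℝ => c + ε * s) (σ.continuousAt_symm ht) hcont,
    σ, hσ, σ.map_target ht, ε, hε, ?_⟩
  filter_upwards [hcont.eventually (σ.open_target.mem_nhds ht)] with s hs
  rw [σ.right_inv hs, σ.right_inv ht]; ring

/-- A curve that moves at unit speed in the charts of `A` for all times. -/
def IsGeodesic (A : Set (OpenPartialHomeomorph M ℝ)) (γ : ℝ → M) : Prop :=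
  ∀ t, IsGeodesicAt A γ t

namespace IsGeodesic

variable {γ η : ℝ → M}

theorem continuous (h : IsGeodesic A γ) : Continuous γ :=
  continuous_iff_continuousAt.2 fun t => (h t).1

theorem comp_affine (h : IsGeodesic A γ) {δ : ℝ} (hδ : δ = 1 ∨ δ = -1) (c : ℝ) :
    IsGeodesic A (fun s => γ (δ * s + c)) := fun _ => (h _).comp_affine hδ

/-- The times near which the curves agree form an open set. It is closed too: at a limit time the
values agree, and in a chart both curves are affine there, so one further common value forces equal
slopes. -/
theorem eq_of_eventuallyEq [T2Space M] (hA : IsometricAtlas A) (hγ : IsGeodesic A γ)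
    (hη : IsGeodesic A η) {t : ℝ} (h : γ =ᶠ[𝓝 t] η) : γ = η := by
  have hopen : IsOpen {t | γ =ᶠ[𝓝 t] η} := isOpen_setOfPred_eventually_nhds
  have hclosed : IsClosed {t | γ =ᶠ[𝓝 t] η} := by
    refine isClosed_of_closure_subset fun t ht => ?_
    have heq : γ t = η t := by
      have : closure {t | γ =ᶠ[𝓝 t] η} ⊆ {t | γ t = η t} :=
        closure_minimal (fun s hs => hs.self_of_nhds) (isClosed_eq hγ.continuous hη.continuous)
      exact this ht
    obtain ⟨σ, hσ, hσt⟩ := hA.exists_mem_source (γ t)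
    obtain ⟨ε, -, h1⟩ := (hγ t).exists_eventually_eq hA hσ hσt
    obtain ⟨ε', -, h2⟩ := (hη t).exists_eventually_eq hA hσ (heq ▸ hσt)
    obtain ⟨s, ⟨hs1, hs2⟩, hs⟩ := mem_closure_iff_nhds.1 ht _ (h1.and h2)
    by_cases hst : s = t
    · exact hst ▸ hs
    · have hsv : γ s = η s := hs.self_of_nhds
      have : ε * (s - t) = ε' * (s - t) := by
        have h3 := hs1.2.1
        rw [hsv, hs2.2.1, heq] at h3
        linarith
      have : ε = ε' := mul_right_cancel₀ (sub_ne_zero.2 hst) this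
      subst this
      filter_upwards [h1, h2] with r hr1 hr2
      rw [hr1.2.2, hr2.2.2, heq]
  have := IsClopen.eq_univ ⟨hclosed, hopen⟩ ⟨t, h⟩
  funext s
  exact (this ▸ mem_univ s : s ∈ {t | γ =ᶠ[𝓝 t] η}).self_of_nhds

/-- Two geodesics through the same point are reparametrizations of each other. -/
theorem eq_or_eq_of_apply_eq [T2Space M] (hA : IsometricAtlas A) (hγ : IsGeodesic A γ)
    (hη : IsGeodesic A η) {a b : ℝ} (h : γ a = η b) :
    (∀ s, γ (a + s) = η (b + s)) ∨ (∀ s, γ (a + s) = η (b - s)) := by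
  obtain ⟨σ, hσ, hσt⟩ := hA.exists_mem_source (γ a)
  obtain ⟨ε, hε, h1⟩ := (hγ a).exists_eventually_eq hA hσ hσt
  obtain ⟨ε', hε', h2⟩ := (hη b).exists_eventually_eq hA hσ (h ▸ hσt)
  -- The slopes ε and ε' of the two curves in a common chart differ by the sign ε * ε', so
  -- reparametrizing `η` by this sign makes the germs equal.
  have key : ∃ δ : ℝ, (δ = 1 ∨ δ = -1) ∧ ∀ s, γ (a + s) = η (b + δ * s) := by
    have hδ : ε * ε' = 1 ∨ ε * ε' = -1 := by
      rcases hε with rfl | rfl <;> rcases hε' with rfl | rfl <;> norm_num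
    refine ⟨ε * ε', hδ, fun s => ?_⟩
    have hev : γ =ᶠ[𝓝 a] fun r => η (ε * ε' * r + (b - ε * ε' * a)) := by
      have hc : Tendsto (fun r => ε * ε' * r + (b - ε * ε' * a)) (𝓝 a) (𝓝 b) := by
        have : ContinuousAt (fun r => ε * ε' * r + (b - ε * ε' * a)) a := by fun_prop
        simpa [ContinuousAt] using this
      filter_upwards [h1, hc.eventually h2] with r hr1 hr2
      rw [hr1.2.2, hr2.2.2, h]
      congr 2
      rcases hε with rfl | rfl <;> rcases hε' with rfl | rfl <;> ring
    rw [hγ.eq_of_eventuallyEq hA (hη.comp_affine hδ _) hev]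
    exact congrArg η (by ring)
  obtain ⟨δ, rfl | rfl, hs⟩ := key
  · exact Or.inl fun s => by rw [hs, one_mul]
  · exact Or.inr fun s => by rw [hs]; congr 1; ring

theorem eventually_injOn (hA : IsometricAtlas A) (h : IsGeodesic A γ) (t : ℝ) :
    ∃ r > 0, InjOn γ (Metric.ball t r) := by
  obtain ⟨σ, hσ, hσt⟩ := hA.exists_mem_source (γ t)
  obtain ⟨ε, hε, h1⟩ := (h t).exists_eventually_eq hA hσ hσt
  obtain ⟨r, hr, hball⟩ := Metric.eventually_nhds_iff_ball.1 h1
  refine ⟨r, hr, fun a ha b hb hab => ?_⟩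
  have h2 := (hball a ha).2.1
  rw [hab, (hball b hb).2.1] at h2
  rcases hε with rfl | rfl <;> linarith

/-- The map y ↦ t + ε (σ y - σ (γ t)) is a continuous local right inverse of `γ`, so images of
neighbourhoods are neighbourhoods. -/
theorem isOpenMap (hA : IsometricAtlas A) (h : IsGeodesic A γ) : IsOpenMap γ := by
  refine IsOpenMap.of_nhds_le fun t => ?_
  intro V hV
  obtain ⟨σ, hσ, hσt⟩ := hA.exists_mem_source (γ t)
  obtain ⟨ε, hε, h1⟩ := (h t).exists_eventually_eq hA hσ hσt
  have hcont : Tendsto (fun y => t + ε * (σ y - σ (γ t))) (𝓝 (γ t)) (𝓝 t) := by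
    have : ContinuousAt (fun y => t + ε * (σ y - σ (γ t))) (γ t) :=
      continuousAt_const.add (continuousAt_const.mul
        ((σ.continuousAt hσt).sub continuousAt_const))
    simpa [ContinuousAt] using this
  filter_upwards [hcont.eventually h1, σ.open_source.mem_nhds hσt,
    hcont.eventually (mem_map.1 hV)] with y hy hys hyV
  have : σ (γ t) + ε * (t + ε * (σ y - σ (γ t)) - t) = σ y := by
    rcases hε with rfl | rfl <;> ring
  have h3 := hy.2.2
  rw [this, σ.left_inv hys] at h3
  exact h3 ▸ hyV

theorem isOpen_range (hA : IsometricAtlas A) (h : IsGeodesic A γ) : IsOpen (range γ) :=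
  (h.isOpenMap hA).isOpen_range

theorem range_subset_of_not_disjoint [T2Space M] (hA : IsometricAtlas A) (hγ : IsGeodesic A γ)
    (hη : IsGeodesic A η) (h : ¬ Disjoint (range γ) (range η)) : range γ ⊆ range η := by
  obtain ⟨_, ⟨a, rfl⟩, ⟨b, hb⟩⟩ := not_disjoint_iff.1 h
  rintro _ ⟨s, rfl⟩
  rcases hγ.eq_or_eq_of_apply_eq hA hη hb.symm with h | h
  · exact ⟨b + (s - a), by rw [← h]; congr 1; ring⟩
  · exact ⟨b - (s - a), by rw [← h]; congr 1; ring⟩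

theorem range_eq_of_not_disjoint [T2Space M] (hA : IsometricAtlas A) (hγ : IsGeodesic A γ)
    (hη : IsGeodesic A η) (h : ¬ Disjoint (range γ) (range η)) : range γ = range η :=
  (hγ.range_subset_of_not_disjoint hA hη h).antisymm
    (hη.range_subset_of_not_disjoint hA hγ fun h' => h h'.symm)

end IsGeodesic

/-- On a compact space, every point is the centre of a coordinate interval of a fixed size. -/
theorem IsometricAtlas.exists_uniform_radius [CompactSpace M] (hA : IsometricAtlas A) :
    ∃ δ > 0, ∀ x : M, ∃ σ ∈ A, x ∈ σ.source ∧ Metric.ball (σ x) δ ⊆ σ.target := by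
  choose σ hσ hσx using hA.exists_mem_source
  -- The factor 2 leaves room: a ball of radius at most `r x` about any point of the ball of radius
  -- `r x` stays in the target.
  have hr : ∀ x, ∃ r > 0, Metric.ball (σ x x) (2 * r) ⊆ (σ x).target := fun x => by
    obtain ⟨r, hr, h⟩ := Metric.isOpen_iff.1 (σ x).open_target _ ((σ x).map_source (hσx x))
    exact ⟨r / 2, by positivity, by convert h using 2; ring⟩
  choose r hr hball using hr
  let U : M → Set M := fun x => (σ x).source ∩ σ x ⁻¹' Metric.ball (σ x x) (r x)
  obtain ⟨s, hs⟩ := isCompact_univ.elim_nhds_subcover U fun x _ =>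
    ((σ x).isOpen_inter_preimage Metric.isOpen_ball).mem_nhds
      ⟨hσx x, Metric.mem_ball_self (hr x)⟩
  obtain ⟨δ, hδ, hδs⟩ : ∃ δ > 0, ∀ x ∈ s, δ ≤ r x := by
    rcases s.eq_empty_or_nonempty with rfl | hne
    · exact ⟨1, one_pos, by simp⟩
    · obtain ⟨y, hy, hmin⟩ := s.exists_min_image r hne
      exact ⟨r y, hr y, hmin⟩
  refine ⟨δ, hδ, fun x => ?_⟩
  obtain ⟨y, hy, hxy⟩ := mem_iUnion₂.1 (hs.2 (mem_univ x))
  refine ⟨σ y, hσ y, hxy.1, fun z hz => hball y ?_⟩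
  have h1 := Metric.mem_ball.1 hxy.2
  have h2 := Metric.mem_ball.1 hz
  have h3 := dist_triangle z (σ y x) (σ y y)
  rw [Metric.mem_ball]
  linarith [hδs y hy]

/-- Past time b the curve continues as the affine curve with the same germ, in a chart with room δ
around γ b. The gain is only δ / 2 because the closed interval must lie in an open ball of radius δ.
-/
theorem IsometricAtlas.extend_right (hA : IsometricAtlas A) {δ : ℝ}
    (hball : ∀ x : M, ∃ σ ∈ A, x ∈ σ.source ∧ Metric.ball (σ x) δ ⊆ σ.target)
    {γ : ℝ → M} {a b : ℝ} (hab : a ≤ b) (h : ∀ t ∈ Icc a b, IsGeodesicAt A γ t) :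
    ∃ η : ℝ → M, EqOn η γ (Iic b) ∧ ∀ t ∈ Icc a (b + δ / 2), IsGeodesicAt A η t := by
  obtain ⟨σ, hσ, hσb, hsub⟩ := hball (γ b)
  obtain ⟨ε, hε, hev⟩ := (h b ⟨hab, le_rfl⟩).exists_eventually_eq hA hσ hσb
  let ζ : ℝ → M := fun s => σ.symm (σ (γ b) - ε * b + ε * s)
  have hζ : ∀ t ∈ Metric.ball b δ, IsGeodesicAt A ζ t := fun t ht => by
    refine isGeodesicAt_symm_affine hσ hε (hsub ?_)
    rw [Metric.mem_ball, Real.dist_eq] at ht ⊢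
    rcases hε with rfl | rfl
    · convert ht using 2; ring
    · rw [abs_sub_comm] at ht
      convert ht using 2; ring
  have hev' : γ =ᶠ[𝓝 b] ζ := by
    filter_upwards [hev] with s hs
    rw [hs.2.2]
    simp only [ζ]
    congr 1; ring
  refine ⟨fun s => if s ≤ b then γ s else ζ s, fun s hs => if_pos hs, fun t ht => ?_⟩
  rcases lt_trichotomy t b with htb | rfl | htb
  · refine (h t ⟨ht.1, htb.le⟩).congr ?_
    filter_upwards [Iio_mem_nhds htb] with s hs
    rw [if_pos (mem_Iio.1 hs).le]
  · refine (h t ⟨hab, le_rfl⟩).congr ?_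
    filter_upwards [hev'] with s hs
    split_ifs
    · rfl
    · exact hs
  · refine (hζ t ?_).congr ?_
    · rw [Metric.mem_ball, Real.dist_eq, abs_of_pos (by linarith)]
      linarith [ht.2]
    · filter_upwards [Ioi_mem_nhds htb] with s hs
      rw [if_neg (not_le.2 hs)]

/-- Extend to the right, reverse time, extend to the right again, and reverse back. -/
theorem IsometricAtlas.extend (hA : IsometricAtlas A) {δ : ℝ} (hδ : 0 < δ)
    (hball : ∀ x : M, ∃ σ ∈ A, x ∈ σ.source ∧ Metric.ball (σ x) δ ⊆ σ.target)
    {γ : ℝ → M} {b : ℝ} (hb : 0 ≤ b) (h : ∀ t ∈ Icc (-b) b, IsGeodesicAt A γ t) :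
    ∃ η : ℝ → M, EqOn η γ (Icc (-b) b) ∧
      ∀ t ∈ Icc (-(b + δ / 2)) (b + δ / 2), IsGeodesicAt A η t := by
  obtain ⟨η, hη, hη'⟩ := hA.extend_right hball (by linarith) h
  have hrev : ∀ t ∈ Icc (-(b + δ / 2)) b, IsGeodesicAt A (fun s => η (-1 * s + 0)) t :=
    fun t ht => IsGeodesicAt.comp_affine (Or.inr rfl)
      (hη' _ ⟨by linarith [ht.2], by linarith [ht.1]⟩)
  obtain ⟨ζ, hζ, hζ'⟩ := hA.extend_right hball (by linarith) hrev
  refine ⟨fun s => ζ (-1 * s + 0), fun s hs => ?_, fun t ht =>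
    IsGeodesicAt.comp_affine (Or.inr rfl) (hζ' _ ⟨by linarith [ht.2], by linarith [ht.1]⟩)⟩
  have h1 : -1 * s + 0 ∈ Iic b := by rw [mem_Iic]; linarith [hs.1]
  simp only [hζ h1]
  rw [← hη (mem_Iic.2 hs.2)]
  congr 1; ring

/-- Through every point of a compact space with an isometric atlas passes a geodesic that is
defined for all times. -/
theorem IsometricAtlas.exists_isGeodesic [CompactSpace M] (hA : IsometricAtlas A) (x : M) :
    ∃ γ : ℝ → M, IsGeodesic A γ ∧ γ 0 = x := by
  obtain ⟨δ, hδ, hball⟩ := hA.exists_uniform_radius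
  obtain ⟨σ, hσ, hσx⟩ := hA.exists_mem_source x
  let P : ℕ → Type _ := fun n =>
    {γ : ℝ → M // ∀ t ∈ Icc (-(n * (δ / 2))) (n * (δ / 2)), IsGeodesicAt A γ t}
  have hstep : ∀ n (γ : P n), ∃ η : P (n + 1),
      EqOn η.1 γ.1 (Icc (-(n * (δ / 2))) (n * (δ / 2))) := fun n γ => by
    obtain ⟨η, h1, h2⟩ := hA.extend hδ hball (by positivity) γ.2
    exact ⟨⟨η, fun t ht => h2 t (by convert ht using 2 <;> push_cast <;> ring)⟩, h1⟩
  choose next hnext using hstep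
  -- For n = 0 the interval is the single time 0, so a chart-affine curve suffices whatever its
  -- values outside the chart.
  let γ₀ : P 0 := ⟨fun s => σ.symm (σ x + 1 * s), fun t ht => by
    have : t = 0 := by simpa using ht
    subst this
    exact isGeodesicAt_symm_affine hσ (Or.inl rfl) (by simpa using σ.map_source hσx)⟩
  let c : ∀ n, P n := fun n => Nat.rec γ₀ next n
  have hmono : ∀ n m, n ≤ m →
      EqOn (c m).1 (c n).1 (Icc (-(n * (δ / 2))) (n * (δ / 2))) := fun n m hnm => by
    induction m, hnm using Nat.le_induction with
    | base => exact fun _ _ => rfl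
    | succ m hm ih =>
      intro t ht
      have hle : (n : ℝ) * (δ / 2) ≤ m * (δ / 2) := by gcongr
      rw [← ih ht]
      exact hnext m (c m) ⟨by linarith [ht.1], by linarith [ht.2]⟩
  have hex : ∀ t : ℝ, ∃ n : ℕ, |t| < n * (δ / 2) := fun t => by
    obtain ⟨n, hn⟩ := exists_nat_gt (|t| / (δ / 2))
    exact ⟨n, (div_lt_iff₀ (by positivity)).1 hn⟩
  -- The strict bound keeps all times near t inside the interval of stage `N t`, so the glued curve
  -- has the germ of that stage at t.
  choose N hN using hex
  have hagree : ∀ n : ℕ, ∀ t, |t| < n * (δ / 2) → (c (N t)).1 t = (c n).1 t := fun n t ht => by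
    rcases le_total n (N t) with h | h
    · exact hmono _ _ h (abs_le.1 ht.le)
    · exact (hmono _ _ h (abs_le.1 (hN t).le)).symm
  refine ⟨fun t => (c (N t)).1 t, fun t => ?_, ?_⟩
  · refine ((c (N t)).2 t (abs_le.1 (hN t).le)).congr ?_
    have : ∀ᶠ s in 𝓝 t, |s| < N t * (δ / 2) :=
      continuous_abs.continuousAt.eventually_lt continuousAt_const (hN t)
    filter_upwards [this] with s hs
    exact (hagree _ _ hs).symm
  · have : (c (N 0)).1 0 = (c 0).1 0 := hmono 0 (N 0) (Nat.zero_le _) (by simp)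
    simp only [this]
    change σ.symm (σ x + 1 * 0) = x
    rw [mul_zero, add_zero, σ.left_inv hσx]

namespace IsGeodesic

variable {γ : ℝ → M}

/-- The complement is a union of ranges of other complete geodesics, each of them open. -/
theorem isClosed_range [T2Space M] [CompactSpace M] (hA : IsometricAtlas A)
    (h : IsGeodesic A γ) : IsClosed (range γ) := by
  refine isOpen_compl_iff.1 (isOpen_iff_mem_nhds.2 fun x hx => ?_)
  obtain ⟨η, hη, rfl⟩ := hA.exists_isGeodesic x
  filter_upwards [(hη.isOpen_range hA).mem_nhds (mem_range_self 0)] with y hy hy'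
  have := hη.range_subset_of_not_disjoint hA h (not_disjoint_iff.2 ⟨y, hy, hy'⟩)
  exact hx (this (mem_range_self 0))

/-- An injective geodesic would be a closed embedding of the line in a compact space. -/
theorem not_injective [T2Space M] [CompactSpace M] (hA : IsometricAtlas A)
    (h : IsGeodesic A γ) : ¬ Function.Injective γ := fun hinj => by
  have hemb : IsOpenEmbedding γ := .of_continuous_injective_isOpenMap h.continuous hinj
    (h.isOpenMap hA)
  have hcomp : IsCompact (γ ⁻¹' univ) :=
    (IsClosedEmbedding.mk hemb.isEmbedding (h.isClosed_range hA)).isCompact_preimage isCompact_univ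
  exact noncompact_univ ℝ (by simpa using hcomp)

/-- The alternative to periodicity is that `γ` is symmetric about the time (a + b) / 2, which
contradicts local injectivity there. -/
theorem periodic_of_apply_eq [T2Space M] (hA : IsometricAtlas A) (h : IsGeodesic A γ)
    {a b : ℝ} (hab : γ a = γ b) : Function.Periodic γ (b - a) := by
  rcases h.eq_or_eq_of_apply_eq hA h hab with hs | hs
  · intro t
    have := hs (t - a)
    rw [add_sub_cancel] at this
    rw [this]
    congr 1; ring
  · exfalso
    obtain ⟨r, hr, hinj⟩ := h.eventually_injOn hA ((a + b) / 2)
    -- This value compares the times (a + b) / 2 + r / 2 and (a + b) / 2 - r / 2.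
    have := hs ((b - a) / 2 + r / 2)
    have := hinj (by rw [Metric.mem_ball, Real.dist_eq, abs_lt]; constructor <;> linarith)
      (by rw [Metric.mem_ball, Real.dist_eq, abs_lt]; constructor <;> linarith) this
    linarith

/-- The periods form a subgroup of ℝ. Local injectivity at 0 prevents it from being dense, so it is
cyclic; non-injectivity makes its generator nonzero. -/
theorem exists_period [T2Space M] [CompactSpace M] (hA : IsometricAtlas A)
    (h : IsGeodesic A γ) :
    ∃ T > 0, ∀ a b, γ a = γ b ↔ ∃ n : ℤ, b - a = n * T := by
  let P : AddSubgroup ℝ :=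
    { carrier := {c | Function.Periodic γ c}
      zero_mem' := fun t => by rw [add_zero]
      add_mem' := fun h1 h2 => h1.add_period h2
      neg_mem' := fun h1 => h1.neg }
  have hP : ∀ a b, γ a = γ b ↔ b - a ∈ P := fun a b =>
    ⟨fun hab => h.periodic_of_apply_eq hA hab, fun hc => by
      have := (hc : Function.Periodic γ (b - a)) a
      rw [← this]; congr 1; ring⟩
  have hcyc : ∃ a, P = AddSubgroup.closure {a} := by
    refine P.dense_or_cyclic.resolve_left fun hd => ?_
    obtain ⟨r, hr, hinj⟩ := h.eventually_injOn hA 0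
    obtain ⟨c, hc, hcP⟩ := hd.exists_mem_open isOpen_Ioo (nonempty_Ioo.2 hr)
    have := hinj (Metric.mem_ball_self hr) (x₂ := c)
      (by rw [Metric.mem_ball, Real.dist_eq, abs_lt]; constructor <;> linarith [hcP.1, hcP.2])
      ((hP _ _).2 (by simpa using hc))
    linarith [hcP.1]
  obtain ⟨T, hT⟩ := hcyc
  have hmem : ∀ c, c ∈ P ↔ ∃ n : ℤ, c = n * T := fun c => by
    rw [hT, AddSubgroup.mem_closure_singleton]
    simp [eq_comm]
  have hT0 : T ≠ 0 := by
    rintro rfl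
    refine h.not_injective hA fun a b hab => ?_
    obtain ⟨n, hn⟩ := (hmem _).1 ((hP a b).1 hab)
    linarith [mul_zero (n : ℝ)]
  refine ⟨|T|, abs_pos.2 hT0, fun a b => ?_⟩
  rw [hP, hmem]
  rcases abs_choice T with hc | hc <;> rw [hc]
  constructor <;> rintro ⟨n, hn⟩ <;> exact ⟨-n, by rw [hn]; push_cast; ring⟩

end IsGeodesic

end Geodesics

/-! ### Calculus on the line: derivatives of absolute value one, and primitives as coordinates -/

/-- A continuous derivative with values ±1 is locally constant, so the function is locally affine.
-/
theorem exists_sign_eventually_eq_of_abs_deriv_eq_one {h : ℝ → ℝ} {x : ℝ}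
    (hh : ContDiffAt ℝ 1 h x) (hd : ∀ᶠ y in 𝓝 x, |deriv h y| = 1) :
    ∃ ε : ℝ, (ε = 1 ∨ ε = -1) ∧ ∀ᶠ y in 𝓝 x, h y = h x + ε * (y - x) := by
  have hdx : |deriv h x| = 1 := hd.self_of_nhds
  have hcont : ContinuousAt (deriv h) x :=
    ContDiffAt.continuousAt (n := 0) (hh.derivWithin (by norm_num))
  refine ⟨deriv h x, eq_or_eq_neg_of_abs_eq hdx, ?_⟩
  have hconst : ∀ᶠ y in 𝓝 x, deriv h y = deriv h x := by
    filter_upwards [hd, Metric.tendsto_nhds.1 hcont 1 one_pos] with y hy1 hy2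
    rw [Real.dist_eq, abs_lt] at hy2
    rcases eq_or_eq_neg_of_abs_eq hy1 with h1 | h1 <;>
    rcases eq_or_eq_neg_of_abs_eq hdx with h2 | h2 <;> rw [h1, h2] at hy2 ⊢ <;> linarith
  have hdiff : ∀ᶠ y in 𝓝 x, DifferentiableAt ℝ h y :=
    (hh.eventually (by simp)).mono fun y hy => hy.differentiableAt (by norm_num)
  obtain ⟨r, hr, hball⟩ := Metric.eventually_nhds_iff_ball.1 (hconst.and hdiff)
  filter_upwards [Metric.ball_mem_nhds x hr] with y hy
  have := (convex_ball x r).is_const_of_fderivWithin_eq_zero (𝕜 := ℝ)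
    (f := fun y => h y - deriv h x * y) ?_ ?_ hy (Metric.mem_ball_self hr)
  · linarith
  · exact fun z hz => ((hball z hz).2.sub (by fun_prop)).differentiableWithinAt
  · intro z hz
    have : HasDerivAt (fun y => h y - deriv h x * y) 0 z := by
      have h1 := (hball z hz).2.hasDerivAt.sub ((hasDerivAt_id z).const_mul (deriv h x))
      rw [(hball z hz).1, mul_one, sub_self] at h1
      exact h1
    rw [fderivWithin_of_isOpen Metric.isOpen_ball hz, this.hasFDerivAt.fderiv]
    ext; simp

/-- A positive smooth function is locally the derivative of a change of coordinates. -/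
theorem exists_openPartialHomeomorph_hasDerivAt {v : ℝ → ℝ} {s : Set ℝ} (hs : IsOpen s)
    (hv : ContDiffOn ℝ ∞ v s) (hpos : ∀ t ∈ s, 0 < v t) {t₀ : ℝ} (ht₀ : t₀ ∈ s) :
    ∃ B : OpenPartialHomeomorph ℝ ℝ, t₀ ∈ B.source ∧ B.source ⊆ s ∧
      ContDiffOn ℝ ∞ B B.source ∧ ContDiffOn ℝ ∞ B.symm B.target ∧
      ∀ t ∈ B.source, HasDerivAt B (v t) t := by
  obtain ⟨r, hr, hball⟩ := Metric.isOpen_iff.1 hs t₀ ht₀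
  -- The coordinate is a primitive of `v`; the inverse function theorem makes it a local
  -- homeomorphism.
  let a : ℝ → ℝ := fun x => ∫ y in t₀..x, v y
  have hvc : ContinuousOn v (Metric.ball t₀ r) := hv.continuousOn.mono hball
  have ha : ∀ x ∈ Metric.ball t₀ r, HasDerivAt a (v x) x := fun x hx => by
    refine intervalIntegral.integral_hasDerivAt_right ?_ ?_ ?_
    · refine (hvc.mono ?_).intervalIntegrable
      exact (convex_ball t₀ r).ordConnected.uIcc_subset (Metric.mem_ball_self hr) hx
    · exact hvc.stronglyMeasurableAtFilter Metric.isOpen_ball x hx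
    · exact hvc.continuousAt (Metric.isOpen_ball.mem_nhds hx)
  have hac : ContDiffOn ℝ ∞ a (Metric.ball t₀ r) := by
    rw [contDiffOn_infty_iff_deriv_of_isOpen Metric.isOpen_ball]
    refine ⟨fun x hx => (ha x hx).differentiableAt.differentiableWithinAt, ?_⟩
    exact (hv.mono hball).congr fun x hx => (ha x hx).deriv
  have hact : ContDiffAt ℝ ∞ a t₀ := hac.contDiffAt (Metric.ball_mem_nhds _ hr)
  have hv0 : v t₀ ≠ 0 := (hpos t₀ ht₀).ne'
  have hstrict := (hact.hasStrictDerivAt' (ha t₀ (Metric.mem_ball_self hr))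
    (by simp)).hasStrictFDerivAt_equiv hv0
  let B₀ := hstrict.toOpenPartialHomeomorph a
  let B := B₀.restrOpen (Metric.ball t₀ r) Metric.isOpen_ball
  have hB : ∀ t ∈ B.source, t ∈ Metric.ball t₀ r := fun t ht => ht.2
  refine ⟨B, ⟨hstrict.mem_toOpenPartialHomeomorph_source, Metric.mem_ball_self hr⟩,
    fun t ht => hball (hB t ht), hac.mono hB, fun x hx => ?_, fun t ht => ha t (hB t ht)⟩
  have hx' := hB _ (B.map_target hx)
  exact (B.contDiffAt_symm_deriv (hpos _ (hball hx')).ne' hx (ha _ hx')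
    (hac.contDiffAt (Metric.isOpen_ball.mem_nhds hx'))).contDiffWithinAt

/-! ### Arc-length charts of an immersed 1-manifold -/

section UnitSpeed

variable {M : Type*} [TopologicalSpace M] [ChartedSpace (EuclideanSpace ℝ (Fin 1)) M]
  {N : ℕ} {e : M → EuclideanSpace ℝ (Fin N)}

/-- The real charts of a `1`-manifold `M` whose inverse is parametrized by arc length with respect
to the map `e` from `M` to a Euclidean space. -/
def unitSpeedCharts (e : M → EuclideanSpace ℝ (Fin N)) : Set (OpenPartialHomeomorph M ℝ) :=
  {σ | ContMDiffOn (𝓡 1) 𝓘(ℝ, ℝ) ∞ σ σ.source ∧ ContMDiffOn 𝓘(ℝ, ℝ) (𝓡 1) ∞ σ.symm σ.target ∧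
    ∀ t ∈ σ.target, ‖deriv (e ∘ σ.symm) t‖ = 1}

theorem contDiffAt_comp_symm (he : ContMDiff (𝓡 1) (𝓡 N) ∞ e) {σ : OpenPartialHomeomorph M ℝ}
    (hσ : ContMDiffOn 𝓘(ℝ, ℝ) (𝓡 1) ∞ σ.symm σ.target) {t : ℝ} (ht : t ∈ σ.target) :
    ContDiffAt ℝ ∞ (e ∘ σ.symm) t :=
  contMDiffAt_iff_contDiffAt.1
    ((he _).comp t (hσ.contMDiffAt (σ.open_target.mem_nhds ht)))

/-- Apply the chain rule to e ∘ σ⁻¹ = (e ∘ τ⁻¹) ∘ (τ ∘ σ⁻¹): both curves have speed one, so the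
transition map has derivative ±1. -/
theorem unitSpeedCharts_compatible (he : ContMDiff (𝓡 1) (𝓡 N) ∞ e)
    {σ τ : OpenPartialHomeomorph M ℝ} (hσ : σ ∈ unitSpeedCharts e) (hτ : τ ∈ unitSpeedCharts e)
    {x : M} (hxσ : x ∈ σ.source) (hxτ : x ∈ τ.source) :
    ∃ ε : ℝ, (ε = 1 ∨ ε = -1) ∧ ∀ᶠ y in 𝓝 x, τ y = τ x + ε * (σ y - σ x) := by
  have hopen : IsOpen (σ.symm.trans τ).source := (σ.symm.trans τ).open_source
  have hmem : ∀ t, t ∈ (σ.symm.trans τ).source ↔ t ∈ σ.target ∧ σ.symm t ∈ τ.source := by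
    intro t; simp
  have hsm : ∀ t ∈ (σ.symm.trans τ).source, ContDiffAt ℝ ∞ (τ ∘ σ.symm) t := fun t ht => by
    rw [hmem] at ht
    exact contMDiffAt_iff_contDiffAt.1 ((hτ.1.contMDiffAt (τ.open_source.mem_nhds ht.2)).comp t
      (hσ.2.1.contMDiffAt (σ.open_target.mem_nhds ht.1)))
  have hx0 : σ x ∈ (σ.symm.trans τ).source := by
    rw [hmem, σ.left_inv hxσ]; exact ⟨σ.map_source hxσ, hxτ⟩
  have hderiv : ∀ t ∈ (σ.symm.trans τ).source, |deriv (τ ∘ σ.symm) t| = 1 := fun t ht => by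
    have ht' := (hmem t).1 ht
    have hev : e ∘ σ.symm =ᶠ[𝓝 t] (e ∘ τ.symm) ∘ (τ ∘ σ.symm) := by
      filter_upwards [hopen.mem_nhds ht] with s hs
      simp [τ.left_inv ((hmem s).1 hs).2]
    have h1 : HasDerivAt (τ ∘ σ.symm) (deriv (τ ∘ σ.symm) t) t :=
      ((hsm t ht).differentiableAt (by simp)).hasDerivAt
    have h2 := ((contDiffAt_comp_symm he hτ.2.1 (τ.map_source ht'.2)).differentiableAt
      (by simp)).hasDerivAt
    have h3 := h2.scomp (h := τ ∘ σ.symm) t h1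
    have h4 := hσ.2.2 t ht'.1
    rw [hev.deriv_eq, h3.deriv, norm_smul, hτ.2.2 _ (τ.map_source ht'.2), mul_one] at h4
    exact h4
  obtain ⟨ε, hε, h⟩ := exists_sign_eventually_eq_of_abs_deriv_eq_one
    ((hsm _ hx0).of_le (by simp)) (eventually_of_mem (hopen.mem_nhds hx0) hderiv)
  refine ⟨ε, hε, ?_⟩
  filter_upwards [(σ.continuousAt hxσ).eventually h, σ.open_source.mem_nhds hxσ] with y hy hys
  simpa [σ.left_inv hys, σ.left_inv hxσ] using hy

/-- The coordinate of the real line as a linear isomorphism from `ℝ¹`. -/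
noncomputable def euclideanOneEquiv : EuclideanSpace ℝ (Fin 1) ≃L[ℝ] ℝ :=
  (EuclideanSpace.equiv (Fin 1) ℝ).trans (ContinuousLinearEquiv.funUnique (Fin 1) ℝ ℝ)

/-- Reparametrize a given chart by arc length, the primitive of the speed. Because `e` is an
immersion the speed is nonzero, which makes it smooth and its primitive a change of coordinates. -/
theorem exists_unitSpeedChart [IsManifold (𝓡 1) ∞ M] (he : ContMDiff (𝓡 1) (𝓡 N) ∞ e)
    (hinj : ∀ x, Function.Injective (mfderiv (𝓡 1) (𝓡 N) e x)) (x : M) :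
    ∃ σ ∈ unitSpeedCharts e, x ∈ σ.source := by
  let κ : OpenPartialHomeomorph M ℝ :=
    (chartAt (EuclideanSpace ℝ (Fin 1)) x).transHomeomorph euclideanOneEquiv.toHomeomorph
  have hκ : ContMDiffOn (𝓡 1) 𝓘(ℝ, ℝ) ∞ κ κ.source :=
    euclideanOneEquiv.contDiff.contMDiff.comp_contMDiffOn (contMDiffOn_chart (I := 𝓡 1))
  have hκs : ContMDiffOn 𝓘(ℝ, ℝ) (𝓡 1) ∞ κ.symm κ.target :=
    (contMDiffOn_chart_symm (I := 𝓡 1) (x := x)).comp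
      (euclideanOneEquiv.symm.contDiff (n := ∞)).contMDiff.contMDiffOn fun t ht => ht
  have hx : x ∈ κ.source := mem_chart_source _ x
  let c := e ∘ κ.symm
  have hc : ∀ t ∈ κ.target, ContDiffAt ℝ ∞ c t := fun t ht => contDiffAt_comp_symm he hκs ht
  have hc0 : ∀ t ∈ κ.target, deriv c t ≠ 0 := fun t ht h0 => by
    have h1 : MDifferentiableAt 𝓘(ℝ, ℝ) (𝓡 1) κ.symm t :=
      (hκs.contMDiffAt (κ.open_target.mem_nhds ht)).mdifferentiableAt (by simp)
    have h2 : MDifferentiableAt (𝓡 1) 𝓘(ℝ, ℝ) κ (κ.symm t) :=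
      (hκ.contMDiffAt (κ.open_source.mem_nhds (κ.map_target ht))).mdifferentiableAt (by simp)
    have h3 : MDifferentiableAt (𝓡 1) (𝓡 N) e (κ.symm t) := (he _).mdifferentiableAt (by simp)
    have h4 : mfderiv 𝓘(ℝ, ℝ) (𝓡 N) c t (1 : ℝ) = (0 : EuclideanSpace ℝ (Fin N)) := by
      rw [mfderiv_eq_fderiv]
      exact h0
    have h5 : mfderiv 𝓘(ℝ, ℝ) (𝓡 1) κ.symm t (1 : ℝ) = 0 := by
      apply hinj (κ.symm t)
      rw [map_zero]
      rw [mfderiv_comp t h3 h1] at h4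
      exact h4
    have h6 : mfderiv 𝓘(ℝ, ℝ) 𝓘(ℝ, ℝ) (κ ∘ κ.symm) t (1 : ℝ) = (0 : ℝ) := by
      rw [mfderiv_comp t h2 h1]
      exact (congrArg (mfderiv (𝓡 1) 𝓘(ℝ, ℝ) κ (κ.symm t)) h5).trans (map_zero _)
    have h7 : κ ∘ κ.symm =ᶠ[𝓝 t] id := by
      filter_upwards [κ.open_target.mem_nhds ht] with s hs using κ.right_inv hs
    rw [h7.mfderiv_eq, mfderiv_id] at h6
    exact one_ne_zero (α := ℝ) h6
  have hv : ContDiffOn ℝ ∞ (fun t => ‖deriv c t‖) κ.target := fun t ht => by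
    have : ContDiffAt ℝ ∞ (deriv c) t := (hc t ht).derivWithin (by simp)
    exact (this.norm ℝ (hc0 t ht)).contDiffWithinAt
  obtain ⟨B, hB0, hBs, hB1, hB2, hB3⟩ := exists_openPartialHomeomorph_hasDerivAt κ.open_target hv
    (fun t ht => norm_pos_iff.2 (hc0 t ht)) (κ.map_source hx)
  refine ⟨κ.trans B, ⟨?_, ?_, ?_⟩, by simpa using ⟨hx, hB0⟩⟩
  · exact hB1.contMDiffOn.comp (hκ.mono fun y hy => hy.1) fun y hy => hy.2
  · exact hκs.comp (hB2.contMDiffOn.mono fun y hy => hy.1) fun y hy => hy.2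
  · intro t ht
    have ht1 : t ∈ B.target := ht.1
    have hb := B.map_target ht1
    have hbt := hBs hb
    have h1 := B.hasDerivAt_symm ht1 (norm_pos_iff.2 (hc0 _ hbt)).ne' (hB3 _ hb)
    have h2 := ((hc _ hbt).differentiableAt (by simp)).hasDerivAt.scomp t h1
    change ‖deriv (c ∘ B.symm) t‖ = 1
    rw [h2.deriv, norm_smul, norm_inv, norm_norm, inv_mul_cancel₀ (norm_pos_iff.2 (hc0 _ hbt)).ne']

theorem isometricAtlas_unitSpeedCharts [IsManifold (𝓡 1) ∞ M] (he : ContMDiff (𝓡 1) (𝓡 N) ∞ e)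
    (hinj : ∀ x, Function.Injective (mfderiv (𝓡 1) (𝓡 N) e x)) :
    IsometricAtlas (unitSpeedCharts e) where
  exists_mem_source x := exists_unitSpeedChart he hinj x
  compatible _ hσ _ hτ _ hxσ hxτ := unitSpeedCharts_compatible he hσ hτ hxσ hxτ

/-- In a unit-speed chart the geodesic is affine of slope ε = ±1, so the smooth inverse is explicit.
-/
theorem IsGeodesicAt.isLocalDiffeomorphAt {A : Set (OpenPartialHomeomorph M ℝ)}
    (hA : IsometricAtlas A) (hsub : A ⊆ unitSpeedCharts e) {γ : ℝ → M} {t : ℝ}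
    (h : IsGeodesicAt A γ t) : IsLocalDiffeomorphAt 𝓘(ℝ, ℝ) (𝓡 1) ∞ γ t := by
  obtain ⟨σ, hσ, hσt⟩ := hA.exists_mem_source (γ t)
  obtain ⟨ε, hε, h1⟩ := h.exists_eventually_eq hA hσ hσt
  obtain ⟨r, hr, hball⟩ := Metric.eventually_nhds_iff_ball.1 h1
  have hεε : ε * ε = 1 := by rcases hε with rfl | rfl <;> norm_num
  have hopen : IsOpen (σ.source ∩ σ ⁻¹' {y | t + ε * (y - σ (γ t)) ∈ Metric.ball t r}) :=
    σ.isOpen_inter_preimage (Metric.isOpen_ball.preimage (by fun_prop))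
  refine ⟨{ toFun := γ
            invFun := fun y => t + ε * (σ y - σ (γ t))
            source := Metric.ball t r
            target := σ.source ∩ σ ⁻¹' {y | t + ε * (y - σ (γ t)) ∈ Metric.ball t r}
            map_source' := fun s hs => ?_
            map_target' := fun y hy => hy.2
            left_inv' := fun s hs => ?_
            right_inv' := fun y hy => ?_
            open_source := Metric.isOpen_ball
            open_target := hopen
            contMDiffOn_toFun := ?_
            contMDiffOn_invFun := ?_ }, Metric.mem_ball_self hr, fun s _ => rfl⟩
  · refine ⟨(hball s hs).1, ?_⟩
    rw [mem_preimage, (hball s hs).2.1, mem_ofPred_eq]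
    convert hs using 1
    linear_combination (s - t) * hεε
  · rw [(hball s hs).2.1]
    linear_combination (s - t) * hεε
  · rw [(hball _ hy.2).2.2]
    have : σ (γ t) + ε * (t + ε * (σ y - σ (γ t)) - t) = σ y := by
      linear_combination (σ y - σ (γ t)) * hεε
    rw [this, σ.left_inv hy.1]
  · have hmaps : ∀ s ∈ Metric.ball t r, σ (γ t) + ε * (s - t) ∈ σ.target := fun s hs => by
      rw [← (hball s hs).2.1]; exact σ.map_source (hball s hs).1
    refine ContMDiffOn.congr (((hsub hσ).2.1).comp (f := fun s : ℝ => σ (γ t) + ε * (s - t))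
      (ContDiff.contMDiff (by fun_prop)).contMDiffOn hmaps) fun s hs => (hball s hs).2.2
  · exact (ContDiff.contMDiff (f := fun y : ℝ => t + ε * (y - σ (γ t)))
      (by fun_prop)).comp_contMDiffOn ((hsub hσ).1.mono inter_subset_left)

end UnitSpeed

/-! ### Classification of closed 1-manifolds -/

section Classification

/-- A closed `1`-manifold is covered by periodic local diffeomorphisms from the line, whose images
are open and pairwise equal or disjoint. -/
theorem exists_periodic_parametrizations (M : Type*) [TopologicalSpace M] [T2Space M]
    [CompactSpace M] [ChartedSpace (EuclideanSpace ℝ (Fin 1)) M] [IsManifold (𝓡 1) ∞ M] :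
    ∃ γ : M → ℝ → M, (∀ x, x ∈ range (γ x)) ∧ (∀ x, IsClopen (range (γ x))) ∧
      (∀ x, IsLocalDiffeomorph 𝓘(ℝ, ℝ) (𝓡 1) ∞ (γ x)) ∧
      (∀ x, ∃ T > 0, ∀ a b, γ x a = γ x b ↔ ∃ n : ℤ, b - a = n * T) ∧
      ∀ x y, ¬ Disjoint (range (γ x)) (range (γ y)) → range (γ x) = range (γ y) := by
  obtain ⟨N, e, he, -, hinj⟩ := exists_embedding_euclidean_of_compact (I := 𝓡 1) (M := M)
  have hA := isometricAtlas_unitSpeedCharts he hinj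
  choose γ hγ hγ0 using hA.exists_isGeodesic
  exact ⟨γ, fun x => ⟨0, hγ0 x⟩, fun x => ⟨(hγ x).isClosed_range hA, (hγ x).isOpen_range hA⟩,
    fun x t => (hγ x t).isLocalDiffeomorphAt hA subset_rfl, fun x => (hγ x).exists_period hA,
    fun x y h => (hγ x).range_eq_of_not_disjoint hA (hγ y) h⟩

section Descent

variable {𝕜 : Type*} [NontriviallyNormedField 𝕜]
  {E E' E'' : Type*} [NormedAddCommGroup E] [NormedSpace 𝕜 E] [NormedAddCommGroup E']
  [NormedSpace 𝕜 E'] [NormedAddCommGroup E''] [NormedSpace 𝕜 E'']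
  {H H' H'' : Type*} [TopologicalSpace H] [TopologicalSpace H'] [TopologicalSpace H'']
  {I : ModelWithCorners 𝕜 E H} {I' : ModelWithCorners 𝕜 E' H'} {I'' : ModelWithCorners 𝕜 E'' H''}
  {L M S : Type*} [TopologicalSpace L] [ChartedSpace H L] [TopologicalSpace M] [ChartedSpace H' M]
  [TopologicalSpace S] [ChartedSpace H'' S] {n : ℕ∞ω}

/-- Near `f a`, `F` equals F ∘ f composed with a smooth local inverse of `f`: smoothness descends
along local diffeomorphisms. -/
theorem IsLocalDiffeomorphAt.contMDiffAt_of_comp {f : L → M} {F : M → S} {a : L}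
    (hf : IsLocalDiffeomorphAt I I' n f a) (hF : ContMDiffAt I I'' n (F ∘ f) a) :
    ContMDiffAt I' I'' n F (f a) := by
  obtain ⟨Φ, ha, hΦ⟩ := hf
  have hfa : f a = Φ a := hΦ ha
  have hmem : f a ∈ Φ.target := hfa ▸ Φ.map_source ha
  have hinv : Φ.invFun (f a) = a := hfa ▸ Φ.left_inv ha
  have h1 : ContMDiffAt I' I n Φ.invFun (f a) :=
    Φ.contMDiffOn_invFun.contMDiffAt (Φ.open_target.mem_nhds hmem)
  have h2 : ContMDiffAt I' I'' n ((F ∘ f) ∘ Φ.invFun) (f a) :=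
    ContMDiffAt.comp (f a) (by rw [hinv]; exact hF) h1
  refine h2.congr_of_eventuallyEq ?_
  filter_upwards [Φ.open_target.mem_nhds hmem] with y hy
  have h3 : f (Φ.invFun y) = y := (hΦ (Φ.map_target hy)).trans (Φ.right_inv hy)
  simp only [Function.comp_apply, h3]

/-- Two quotients of the same manifold by local diffeomorphisms with the same fibres are
diffeomorphic. -/
theorem nonempty_diffeomorph_of_isLocalDiffeomorph [Nonempty L] [IsManifold I' n M] {f : L → M}
    {g : L → S} (hf : IsLocalDiffeomorph I I' n f) (hg : IsLocalDiffeomorph I I'' n g)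
    (U : TopologicalSpace.Opens M) (hU : (U : Set M) = range f) (hsurj : Function.Surjective g)
    (hfg : ∀ a b, f a = f b ↔ g a = g b) : Nonempty (Diffeomorph I' I'' U S n) := by
  classical
  -- Only the values on the range of `f` matter; the arbitrary value elsewhere makes `F` defined on
  -- `M`, so that smoothness can be tested there before restricting to `U`.
  let F : M → S := fun y => if h : ∃ a, f a = y then g h.choose else g (Classical.arbitrary L)
  have hF : ∀ a, F (f a) = g a := fun a => by
    have h : ∃ b, f b = f a := ⟨a, rfl⟩
    simp only [F, dif_pos h]
    exact (hfg _ _).1 h.choose_spec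
  choose r hr using hsurj
  have hG : ∀ a, f (r (g a)) = f a := fun a => (hfg _ _).2 (hr _)
  have hmem : ∀ a, f a ∈ U := fun a => by
    rw [← SetLike.mem_coe, hU]; exact mem_range_self a
  have hFsm : ContMDiff I' I'' n (F ∘ (Subtype.val : U → M)) := fun u => by
    obtain ⟨a, ha⟩ : (u : M) ∈ range f := hU ▸ u.2
    refine ContMDiffAt.comp u ?_ (contMDiff_subtype_val u)
    rw [← ha]
    refine (hf a).contMDiffAt_of_comp ?_
    have : F ∘ f = g := funext hF
    rw [this]
    exact (hg a).contMDiffAt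
  have hGsm : ContMDiff I'' I' n (fun s => (⟨f (r s), hmem _⟩ : U)) := by
    have h1 : ContMDiff I'' I' n (fun s => f (r s)) := fun s => by
      rw [← hr s]
      refine (hg (r s)).contMDiffAt_of_comp ?_
      have : (fun s => f (r s)) ∘ g = f := funext hG
      rw [this]
      exact (hf _).contMDiffAt
    rw [ContMDiff.iff_comp_isImmersion (Manifold.IsImmersion.of_opens U)]
    exact ⟨h1.continuous.subtype_mk _, h1⟩
  exact ⟨{ toFun := F ∘ Subtype.val
           invFun := fun s => ⟨f (r s), hmem _⟩
           left_inv := fun u => by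
            obtain ⟨a, ha⟩ : (u : M) ∈ range f := hU ▸ u.2
            apply Subtype.ext
            simp only [Function.comp_apply]
            rw [← ha, hF, hG]
           right_inv := fun s => by
            simp only [Function.comp_apply]
            rw [hF, hr]
           contMDiff_toFun := hFsm
           contMDiff_invFun := hGsm }⟩

end Descent

instance : PreconnectedSpace UnitCircle :=
  Subtype.preconnectedSpace (isPreconnected_sphere (by
    rw [← Module.finrank_eq_rank, finrank_euclideanSpace_fin]; norm_num) _ _)

/-- For every `T > 0` the circle is the quotient of the line by the translations by multiples
of `T`. -/
theorem exists_circle_parametrization {T : ℝ} (hT : 0 < T) :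
    ∃ g : ℝ → UnitCircle, IsLocalDiffeomorph 𝓘(ℝ, ℝ) (𝓡 1) ∞ g ∧ Function.Surjective g ∧
      ∀ a b, g a = g b ↔ ∃ n : ℤ, b - a = n * T := by
  -- The circle is connected, so a single geodesic covers it; its period is then rescaled to T
  -- without being computed.
  obtain ⟨γ, hmem, hclopen, hloc, hper, -⟩ := exists_periodic_parametrizations UnitCircle
  let x₀ : UnitCircle := ⟨EuclideanSpace.single 0 1, by simp⟩
  obtain ⟨T', hT', hper⟩ := hper x₀
  have hsurj : Function.Surjective (γ x₀) :=
    range_eq_univ.1 ((hclopen x₀).eq_univ ⟨_, hmem x₀⟩)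
  have hc : T' / T ≠ 0 := by positivity
  let m : ℝ ≃L[ℝ] ℝ := ContinuousLinearEquiv.unitsEquivAut ℝ (Units.mk0 (T' / T) hc)
  have hm : ∀ t, m t = t * (T' / T) := fun t => by simp [m]
  refine ⟨γ x₀ ∘ m, fun t => ?_, hsurj.comp m.surjective, fun a b => ?_⟩
  · exact (m.toDiffeomorph.isLocalDiffeomorph t).comp (𝓡 1) UnitCircle (hloc x₀ (m t))
  · simp only [Function.comp_apply, hper, hm]
    refine exists_congr fun n => ?_
    rw [← sub_mul, mul_div_assoc', div_eq_iff hT.ne']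
    constructor
    · intro h; exact mul_right_cancel₀ hT'.ne' (by linarith)
    · intro h; rw [h]; ring

theorem ClosedManifold.isFiniteDisjointUnionOfCircles (M : ClosedManifold.{u} 1) :
    M.IsFiniteDisjointUnionOfCircles := by
  classical
  obtain ⟨γ, hmem, hclopen, hloc, hper, hdisj⟩ := exists_periodic_parametrizations M
  obtain ⟨s, -, hs⟩ := isCompact_univ.elim_nhds_subcover (fun x => range (γ x))
    fun x _ => (hclopen x).isOpen.mem_nhds (hmem x)
  -- Taking the ranges as a set of sets removes repetitions, so different indices give disjoint
  -- ranges.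
  let R : Finset (Set M) := s.image fun x => range (γ x)
  have hR : ∀ V : R, ∃ x, range (γ x) = V := fun V => by
    obtain ⟨x, -, hx⟩ := Finset.mem_image.1 V.2
    exact ⟨x, hx⟩
  choose c hc using hR
  let U : Fin R.card → TopologicalSpace.Opens M := fun i =>
    ⟨range (γ (c (R.equivFin.symm i))), (hclopen _).isOpen⟩
  refine ⟨R.card, U, fun i j hij => ?_, ?_, fun i => ?_⟩
  · change Disjoint (U i) (U j)
    rw [← TopologicalSpace.Opens.coe_disjoint]
    by_contra h
    have := hdisj _ _ h
    rw [hc, hc] at this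
    exact hij (R.equivFin.symm.injective (Subtype.ext this))
  · rw [eq_top_iff]
    intro x _
    obtain ⟨y, hy, hxy⟩ := mem_iUnion₂.1 (hs (mem_univ x))
    have hyR : range (γ y) ∈ R := Finset.mem_image_of_mem _ hy
    rw [TopologicalSpace.Opens.mem_iSup]
    refine ⟨R.equivFin ⟨_, hyR⟩, ?_⟩
    change x ∈ range (γ (c (R.equivFin.symm (R.equivFin ⟨_, hyR⟩))))
    rw [hc, Equiv.symm_apply_apply]
    exact hxy
  · obtain ⟨T, hT, hper⟩ := hper (c (R.equivFin.symm i))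
    obtain ⟨g, hg, hsurj, hgper⟩ := exists_circle_parametrization hT
    exact nonempty_diffeomorph_of_isLocalDiffeomorph (hloc _) hg (U i) rfl hsurj
      fun a b => (hper a b).trans (hgper a b).symm

end Classification

/-! ### Domains in ℝⁿ as manifolds with boundary -/

section RegularDomain

variable {n : ℕ} [NeZero n] {D : Set (EuclideanSpace ℝ (Fin n))}

/-- A smooth change of coordinates on an open subset of `ℝⁿ` that maps the part of `D` in this
subset to the half-space. -/
structure StraighteningChart (D : Set (EuclideanSpace ℝ (Fin n))) where
  chart : OpenPartialHomeomorph (EuclideanSpace ℝ (Fin n)) (EuclideanSpace ℝ (Fin n))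
  mem_iff : ∀ x ∈ chart.source, x ∈ D ↔ 0 ≤ chart x 0
  contDiffOn : ContDiffOn ℝ ∞ chart chart.source
  contDiffOn_symm : ContDiffOn ℝ ∞ chart.symm chart.target

namespace StraighteningChart

variable (ψ ψ' : StraighteningChart D)

/-- The inverse of the half-space model retracts ℝⁿ to the half-space; on the image of `D` it
changes nothing. -/
theorem coe_symm_chart {x : EuclideanSpace ℝ (Fin n)} (hx : x ∈ ψ.chart.source) (hD : x ∈ D) :
    ((𝓡∂ n).symm (ψ.chart x)).1 = ψ.chart x := by
  refine (𝓡∂ n).right_inv ?_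
  rw [range_modelWithCornersEuclideanHalfSpace]
  exact (ψ.mem_iff x hx).1 hD

theorem symm_mem (y : EuclideanHalfSpace n) (hy : y.1 ∈ ψ.chart.target) :
    ψ.chart.symm y.1 ∈ D := by
  rw [ψ.mem_iff _ (ψ.chart.map_target hy), ψ.chart.right_inv hy]
  exact y.2

open Classical in
/-- The chart of the subspace `D` given by a straightening chart. -/
noncomputable def restrict [Nonempty D] : OpenPartialHomeomorph D (EuclideanHalfSpace n) where
  toFun x := (𝓡∂ n).symm (ψ.chart x)
  invFun y := if h : ψ.chart.symm y.1 ∈ D then ⟨_, h⟩ else Classical.arbitrary D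
  source := Subtype.val ⁻¹' ψ.chart.source
  target := Subtype.val ⁻¹' ψ.chart.target
  map_source' x hx := by
    rw [mem_preimage, ψ.coe_symm_chart hx x.2]
    exact ψ.chart.map_source hx
  map_target' y hy := by
    rw [dif_pos (ψ.symm_mem y hy)]
    exact ψ.chart.map_target hy
  left_inv' x hx := by
    have h : ψ.chart.symm ((𝓡∂ n).symm (ψ.chart x)).1 = x := by
      rw [ψ.coe_symm_chart hx x.2, ψ.chart.left_inv hx]
    rw [dif_pos (by rw [h]; exact x.2)]
    exact Subtype.ext h
  right_inv' y hy := by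
    rw [dif_pos (ψ.symm_mem y hy)]
    simp only [ψ.chart.right_inv hy]
    exact (𝓡∂ n).left_inv y
  open_source := ψ.chart.open_source.preimage continuous_subtype_val
  open_target := ψ.chart.open_target.preimage continuous_subtype_val
  continuousOn_toFun := (𝓡∂ n).continuous_symm.comp_continuousOn
    (ψ.chart.continuousOn.comp continuous_subtype_val.continuousOn fun _ hx => hx)
  continuousOn_invFun := by
    rw [Topology.IsInducing.subtypeVal.continuousOn_iff]
    refine (ψ.chart.continuousOn_symm.comp continuous_subtype_val.continuousOn
      fun _ hx => hx).congr fun y hy => ?_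
    simp only [Function.comp_apply]
    rw [dif_pos (ψ.symm_mem y hy)]

variable [Nonempty D]

theorem coe_restrict {x : D} (hx : x.1 ∈ ψ.chart.source) : (ψ.restrict x).1 = ψ.chart x :=
  ψ.coe_symm_chart hx x.2

theorem coe_restrict_symm {y : EuclideanHalfSpace n} (hy : y.1 ∈ ψ.chart.target) :
    (ψ.restrict.symm y).1 = ψ.chart.symm y.1 := by
  exact congrArg Subtype.val (dif_pos (ψ.symm_mem y hy))

/-- The transition map is the restriction to the half-space of the smooth ambient transition map. -/
theorem contDiffOn_transition : ContDiffOn ℝ ∞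
    ((𝓡∂ n) ∘ (ψ.restrict.symm.trans ψ'.restrict) ∘ (𝓡∂ n).symm)
    ((𝓡∂ n).symm ⁻¹' (ψ.restrict.symm.trans ψ'.restrict).source ∩ range (𝓡∂ n)) := by
  have key : ∀ z ∈ (𝓡∂ n).symm ⁻¹' (ψ.restrict.symm.trans ψ'.restrict).source ∩ range (𝓡∂ n),
      z ∈ ψ.chart.target ∧ ψ.chart.symm z ∈ ψ'.chart.source ∧
      ((𝓡∂ n) ∘ (ψ.restrict.symm.trans ψ'.restrict) ∘ (𝓡∂ n).symm) z =
        (ψ'.chart ∘ ψ.chart.symm) z := by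
    rintro _ ⟨⟨h1, h2⟩, ⟨y, rfl⟩⟩
    rw [(𝓡∂ n).left_inv] at h1 h2
    have h1' : y.1 ∈ ψ.chart.target := h1
    have h2' : (ψ.restrict.symm y).1 ∈ ψ'.chart.source := h2
    simp only [Function.comp_apply, (𝓡∂ n).left_inv]
    refine ⟨h1', by rwa [ψ.coe_restrict_symm h1'] at h2', ?_⟩
    exact (ψ'.coe_restrict h2').trans (congrArg _ (ψ.coe_restrict_symm h1'))
  refine ContDiffOn.congr ?_ fun z hz => (key z hz).2.2
  exact ψ'.contDiffOn.comp (ψ.contDiffOn_symm.mono fun z hz => (key z hz).1)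
    fun z hz => (key z hz).2.1

/-- The structure of manifold with boundary on `D` given by a straightening chart around each
point. -/
@[reducible]
noncomputable def chartedSpace (ψ : D → StraighteningChart D)
    (hψ : ∀ x : D, x.1 ∈ (ψ x).chart.source) : ChartedSpace (EuclideanHalfSpace n) D where
  atlas := range fun x => (ψ x).restrict
  chartAt x := (ψ x).restrict
  mem_chart_source x := hψ x
  chart_mem_atlas x := mem_range_self x

theorem isManifold (ψ : D → StraighteningChart D) (hψ : ∀ x : D, x.1 ∈ (ψ x).chart.source) :
    letI := chartedSpace ψ hψ
    IsManifold (𝓡∂ n) ∞ D := by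
  let := chartedSpace ψ hψ
  refine isManifold_of_contDiffOn _ _ _ ?_
  rintro _ _ ⟨x, rfl⟩ ⟨y, rfl⟩
  exact (ψ x).contDiffOn_transition (ψ y)

/-- In a straightening chart and its restriction to `D` the inclusion is the identity, so the
complement is trivial. -/
theorem isSmoothEmbedding_val (ψ : D → StraighteningChart D)
    (hψ : ∀ x : D, x.1 ∈ (ψ x).chart.source) :
    letI := chartedSpace ψ hψ
    Manifold.IsSmoothEmbedding (𝓡∂ n) (𝓡 n) ∞ (Subtype.val : D → EuclideanSpace ℝ (Fin n)) := by
  let := chartedSpace ψ hψ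
  have := isManifold ψ hψ
  refine ⟨Manifold.IsImmersionOfComplement.isImmersion (F := PUnit) fun x => ?_, .subtypeVal⟩
  refine Manifold.IsImmersionAtOfComplement.mk_of_continuousAt continuous_subtype_val.continuousAt
    (.prodUnique ℝ _ _) (ψ x).restrict (ψ x).chart (hψ x) (hψ x)
    (IsManifold.chart_mem_maximalAtlas x) ?_ ?_
  · exact (ψ x).chart.mem_maximalAtlas_of_contMDiffOn (ψ x).contDiffOn.contMDiffOn
      (ψ x).contDiffOn_symm.contMDiffOn
  · intro z hz
    rw [OpenPartialHomeomorph.extend_target] at hz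
    obtain ⟨h1, ⟨y, rfl⟩⟩ := hz
    rw [mem_preimage, (𝓡∂ n).left_inv] at h1
    have h1' : y.1 ∈ (ψ x).chart.target := h1
    have h2 : (ψ x).chart ((ψ x).restrict.symm y).1 = y.1 := by
      rw [(ψ x).coe_restrict_symm h1', (ψ x).chart.right_inv h1']
    have h3 : (𝓡∂ n).symm y.1 = y := (𝓡∂ n).left_inv y
    simpa [OpenPartialHomeomorph.extend, h3] using h2

theorem mem_boundary_iff (ψ : D → StraighteningChart D)
    (hψ : ∀ x : D, x.1 ∈ (ψ x).chart.source) (x : D) :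
    letI := chartedSpace ψ hψ
    x ∈ (𝓡∂ n).boundary D ↔ (ψ x).chart x.1 0 = 0 := by
  let := chartedSpace ψ hψ
  have h1 : extChartAt (𝓡∂ n) x x = (ψ x).chart x.1 := (ψ x).coe_restrict (hψ x)
  change extChartAt (𝓡∂ n) x x ∈ frontier (range (𝓡∂ n)) ↔ _
  rw [h1, frontier_range_modelWithCornersEuclideanHalfSpace]
  exact eq_comm

end StraighteningChart

end RegularDomain

/-! ### The disc as a manifold with boundary -/

section Disc

/-- The circle coordinate and the collar coordinate as coordinates of the plane. -/
noncomputable def collarEquiv : (EuclideanSpace ℝ (Fin 1) × ℝ) ≃L[ℝ] EuclideanSpace ℝ (Fin 2) :=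
  LinearEquiv.toContinuousLinearEquiv
    -- The collar coordinate goes first because the half-space is cut out by coordinate 0.
    { toFun := fun p => !₂[p.2, p.1 0]
      invFun := fun y => (!₂[y 1], y 0)
      map_add' := fun p q => by ext i; fin_cases i <;> simp
      map_smul' := fun c p => by ext i; fin_cases i <;> simp
      left_inv := fun p => by
        refine Prod.ext ?_ rfl
        ext i; fin_cases i; rfl
      right_inv := fun y => by ext i; fin_cases i <;> rfl }

theorem collarEquiv_apply_zero (p : EuclideanSpace ℝ (Fin 1) × ℝ) : collarEquiv p 0 = p.2 := rfl

/-- A point of the circle. -/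
noncomputable def circleBasePoint : UnitCircle := ⟨EuclideanSpace.single 0 1, by simp⟩

open Classical in
/-- Radial projection to the circle; the value at the origin is irrelevant. -/
noncomputable def radialProjection (x : EuclideanSpace ℝ (Fin 2)) : UnitCircle :=
  if h : x ≠ 0 then ⟨‖x‖⁻¹ • x, by simp [norm_smul, norm_ne_zero_iff.2 h]⟩ else circleBasePoint

theorem coe_radialProjection {x : EuclideanSpace ℝ (Fin 2)} (h : x ≠ 0) :
    (radialProjection x : EuclideanSpace ℝ (Fin 2)) = ‖x‖⁻¹ • x := by
  rw [radialProjection, dif_pos h]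

theorem radialProjection_smul_coe {r : ℝ} (hr : 0 < r) (x : UnitCircle) :
    radialProjection (r • (x : EuclideanSpace ℝ (Fin 2))) = x := by
  have hx : ‖(x : EuclideanSpace ℝ (Fin 2))‖ = 1 := norm_eq_of_mem_sphere x
  have h0 : r • (x : EuclideanSpace ℝ (Fin 2)) ≠ 0 :=
    smul_ne_zero hr.ne' (ne_zero_of_mem_unit_sphere x)
  apply Subtype.ext
  rw [coe_radialProjection h0, norm_smul, hx, mul_one, Real.norm_of_nonneg hr.le, smul_smul,
    inv_mul_cancel₀ hr.ne', one_smul]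

theorem radialProjection_coe (x : UnitCircle) :
    radialProjection (x : EuclideanSpace ℝ (Fin 2)) = x := by
  simpa using radialProjection_smul_coe one_pos x

theorem contMDiffAt_radialProjection {x : EuclideanSpace ℝ (Fin 2)} (h : x ≠ 0) :
    ContMDiffAt (𝓡 2) (𝓡 1) ∞ radialProjection x := by
  -- Smoothness of a map into the sphere is tested in the ambient plane for maps smooth everywhere,
  -- hence the restriction to the punctured plane.
  let U : TopologicalSpace.Opens (EuclideanSpace ℝ (Fin 2)) := ⟨{0}ᶜ, isOpen_compl_singleton⟩
  have hne : ∀ y : U, y.1 ≠ 0 := fun y => y.2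
  have hsm : ContMDiff (𝓡 2) (𝓡 2) ∞
      (fun y : U => ((radialProjection y.1 : UnitCircle) : EuclideanSpace ℝ (Fin 2))) :=
    fun y => by
      have h1 : ContDiffAt ℝ ∞ (fun z : EuclideanSpace ℝ (Fin 2) => ‖z‖⁻¹ • z) y.1 :=
        ((contDiffAt_norm ℝ (hne y)).inv (norm_ne_zero_iff.2 (hne y))).smul contDiffAt_id
      refine (h1.contMDiffAt.comp y (contMDiff_subtype_val y)).congr_of_eventuallyEq
        (Eventually.of_forall fun z => coe_radialProjection (hne z))
  have : Fact (Module.finrank ℝ (EuclideanSpace ℝ (Fin 2)) = 1 + 1) :=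
    ⟨finrank_euclideanSpace_fin⟩
  have h2 := hsm.codRestrict_sphere (n := 1) fun y => (radialProjection y.1).2
  exact (contMDiffAt_subtype_iff (U := U) (x := ⟨x, h⟩)).1 (h2 ⟨x, h⟩)

/-- Collar coordinates of the plane minus the origin: a coordinate of the circle and the distance
to the circle. -/
noncomputable def collarChart (φ : OpenPartialHomeomorph UnitCircle (EuclideanSpace ℝ (Fin 1))) :
    OpenPartialHomeomorph (EuclideanSpace ℝ (Fin 2)) (EuclideanSpace ℝ (Fin 2)) where
  toFun x := collarEquiv (φ (radialProjection x), 1 - ‖x‖)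
  invFun y := (1 - (collarEquiv.symm y).2) •
    (φ.symm (collarEquiv.symm y).1 : EuclideanSpace ℝ (Fin 2))
  source := {0}ᶜ ∩ radialProjection ⁻¹' φ.source
  target := collarEquiv.symm ⁻¹' (φ.target ×ˢ Iio 1)
  map_source' x hx := by
    have : x ≠ 0 := hx.1
    simpa using ⟨φ.map_source hx.2, this⟩
  map_target' y hy := by
    have hpos : 0 < 1 - (collarEquiv.symm y).2 := sub_pos.2 hy.2
    refine ⟨smul_ne_zero hpos.ne' (ne_zero_of_mem_unit_sphere _), ?_⟩
    rw [mem_preimage, radialProjection_smul_coe hpos]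
    exact φ.map_target hy.1
  left_inv' x hx := by
    have h0 : x ≠ 0 := hx.1
    simp only [ContinuousLinearEquiv.symm_apply_apply]
    rw [φ.left_inv hx.2, coe_radialProjection h0, smul_smul, sub_sub_cancel,
      mul_inv_cancel₀ (norm_ne_zero_iff.2 h0), one_smul]
  right_inv' y hy := by
    have hpos : 0 < 1 - (collarEquiv.symm y).2 := sub_pos.2 hy.2
    rw [radialProjection_smul_coe hpos, φ.right_inv hy.1, norm_smul, norm_eq_of_mem_sphere,
      mul_one, Real.norm_of_nonneg hpos.le, sub_sub_cancel]
    exact collarEquiv.apply_symm_apply y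
  open_source := ContinuousOn.isOpen_inter_preimage
    (fun _ hx => (contMDiffAt_radialProjection hx).continuousAt.continuousWithinAt)
    isOpen_compl_singleton φ.open_source
  open_target := (φ.open_target.prod isOpen_Iio).preimage collarEquiv.symm.continuous
  continuousOn_toFun := collarEquiv.continuous.comp_continuousOn
    ((φ.continuousOn.comp (fun _ hx => (contMDiffAt_radialProjection
      hx.1).continuousAt.continuousWithinAt) fun _ hx => hx.2).prodMk (by fun_prop))
  continuousOn_invFun := by
    refine ContinuousOn.smul (f := fun y => 1 - (collarEquiv.symm y).2)
      (Continuous.continuousOn (by fun_prop))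
      (continuous_subtype_val.comp_continuousOn (φ.continuousOn_symm.comp
        (f := fun y => (collarEquiv.symm y).1) (Continuous.continuousOn (by fun_prop)) ?_))
    exact fun y hy => hy.1

/-- The straightening chart of the disc near its boundary that extends a chart of the circle. -/
noncomputable def collarStraighteningChart
    (φ : OpenPartialHomeomorph UnitCircle (EuclideanSpace ℝ (Fin 1)))
    (hφ : φ ∈ IsManifold.maximalAtlas (𝓡 1) ∞ UnitCircle) :
    StraighteningChart (Metric.closedBall (0 : EuclideanSpace ℝ (Fin 2)) 1) where
  chart := collarChart φ
  mem_iff x _ := by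
    change _ ↔ 0 ≤ 1 - ‖x‖
    rw [mem_closedBall_zero_iff, sub_nonneg]
  contDiffOn := by
    refine collarEquiv.contDiff.comp_contDiffOn (ContDiffOn.prodMk ?_ ?_)
    · refine contMDiffOn_iff_contDiffOn.1 ((contMDiffOn_of_mem_maximalAtlas hφ).comp
        (fun x hx => (contMDiffAt_radialProjection hx.1).contMDiffWithinAt) fun x hx => hx.2)
    · exact fun x hx => (contDiffAt_const.sub (contDiffAt_norm ℝ hx.1)).contDiffWithinAt
  contDiffOn_symm := by
    have : Fact (Module.finrank ℝ (EuclideanSpace ℝ (Fin 2)) = 1 + 1) :=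
      ⟨finrank_euclideanSpace_fin⟩
    refine ContDiffOn.smul (f := fun y => 1 - (collarEquiv.symm y).2)
      (ContDiff.contDiffOn (by fun_prop)) ?_
    refine contMDiffOn_iff_contDiffOn.1 ((contMDiff_coe_sphere (n := 1)).comp_contMDiffOn
      ((contMDiffOn_symm_of_mem_maximalAtlas hφ).comp
        (f := fun y => (collarEquiv.symm y).1) (ContDiff.contMDiff ?_).contMDiffOn
        fun y hy => hy.1))
    fun_prop

/-- The straightening chart of the disc on its interior, a translation. -/
noncomputable def interiorStraighteningChart :
    StraighteningChart (Metric.closedBall (0 : EuclideanSpace ℝ (Fin 2)) 1) where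
  -- Shifting the first coordinate by 2 moves the open unit ball into the interior of the
  -- half-space.
  chart := (Homeomorph.addRight (EuclideanSpace.single 0 2)).toOpenPartialHomeomorph.restrOpen
    (Metric.ball 0 1) Metric.isOpen_ball
  mem_iff x hx := by
    have hx' : x ∈ Metric.ball (0 : EuclideanSpace ℝ (Fin 2)) 1 := hx.2
    refine iff_of_true (Metric.ball_subset_closedBall hx') ?_
    have h1 := (PiLp.norm_apply_le x 0).trans_lt (mem_ball_zero_iff.1 hx')
    have h2 := (abs_lt.1 h1).1
    change 0 ≤ (x + EuclideanSpace.single 0 2 : EuclideanSpace ℝ (Fin 2)) 0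
    simp
    linarith
  contDiffOn := (contDiff_id.add contDiff_const).contDiffOn
  contDiffOn_symm := (contDiff_id.add contDiff_const).contDiffOn

open Classical in
/-- A straightening chart around each point of the disc. -/
noncomputable def discStraighteningChart (x : UnitDisc) :
    StraighteningChart (Metric.closedBall (0 : EuclideanSpace ℝ (Fin 2)) 1) :=
  if h : x.1 ∈ Metric.sphere (0 : EuclideanSpace ℝ (Fin 2)) 1 then
    collarStraighteningChart (chartAt (EuclideanSpace ℝ (Fin 1)) (⟨x.1, h⟩ : UnitCircle))
      (IsManifold.chart_mem_maximalAtlas _)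
  else interiorStraighteningChart

theorem discStraighteningChart_circleToDisc (x : UnitCircle) :
    discStraighteningChart (circleToDisc x) =
      collarStraighteningChart (chartAt (EuclideanSpace ℝ (Fin 1)) x)
        (IsManifold.chart_mem_maximalAtlas _) :=
  dif_pos x.2

theorem mem_collarChart_source {φ : OpenPartialHomeomorph UnitCircle (EuclideanSpace ℝ (Fin 1))}
    {x : UnitCircle} (hx : x ∈ φ.source) : x.1 ∈ (collarChart φ).source :=
  ⟨ne_zero_of_mem_unit_sphere x, by rwa [mem_preimage, radialProjection_coe]⟩

theorem collarChart_coe (φ : OpenPartialHomeomorph UnitCircle (EuclideanSpace ℝ (Fin 1)))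
    (x : UnitCircle) : collarChart φ x.1 = collarEquiv (φ x, 0) := by
  change collarEquiv (φ (radialProjection x.1), 1 - ‖x.1‖) = _
  rw [radialProjection_coe, norm_eq_of_mem_sphere, sub_self]

theorem mem_discStraighteningChart_source (x : UnitDisc) :
    x.1 ∈ (discStraighteningChart x).chart.source := by
  by_cases h : x.1 ∈ Metric.sphere (0 : EuclideanSpace ℝ (Fin 2)) 1
  · have := discStraighteningChart_circleToDisc ⟨x.1, h⟩
    change discStraighteningChart x = _ at this
    rw [this]
    exact mem_collarChart_source (x := ⟨x.1, h⟩) (mem_chart_source _ _)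
  · rw [discStraighteningChart, dif_neg h]
    refine ⟨mem_univ _, ?_⟩
    rw [mem_sphere_zero_iff_norm] at h
    exact mem_ball_zero_iff.2 (lt_of_le_of_ne (mem_closedBall_zero_iff.1 x.2) h)

instance : Nonempty UnitDisc := ⟨⟨0, by simp⟩⟩

noncomputable instance : ChartedSpace (EuclideanHalfSpace 2) UnitDisc :=
  StraighteningChart.chartedSpace discStraighteningChart mem_discStraighteningChart_source

instance : IsManifold (𝓡∂ 2) ∞ UnitDisc :=
  StraighteningChart.isManifold discStraighteningChart mem_discStraighteningChart_source

theorem isSmoothEmbedding_disc_val : Manifold.IsSmoothEmbedding (𝓡∂ 2) (𝓡 2) ∞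
    (Subtype.val : UnitDisc → EuclideanSpace ℝ (Fin 2)) :=
  StraighteningChart.isSmoothEmbedding_val discStraighteningChart mem_discStraighteningChart_source

theorem boundary_disc : (𝓡∂ 2).boundary UnitDisc = range circleToDisc := by
  ext x
  rw [StraighteningChart.mem_boundary_iff discStraighteningChart
    mem_discStraighteningChart_source x]
  by_cases h : x.1 ∈ Metric.sphere (0 : EuclideanSpace ℝ (Fin 2)) 1
  · have hx : x = circleToDisc ⟨x.1, h⟩ := rfl
    refine iff_of_true ?_ ⟨_, hx.symm⟩
    rw [hx, discStraighteningChart_circleToDisc]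
    exact (congrArg (fun y : EuclideanSpace ℝ (Fin 2) => y 0) (collarChart_coe _ ⟨x.1, h⟩)).trans
      (collarEquiv_apply_zero _)
  · refine iff_of_false ?_ ?_
    · have hball := mem_discStraighteningChart_source x
      rw [discStraighteningChart, dif_neg h] at hball ⊢
      have h1 := (PiLp.norm_apply_le x.1 0).trans_lt (mem_ball_zero_iff.1 hball.2)
      have h2 := (abs_lt.1 h1).1
      change ¬ (x.1 + EuclideanSpace.single 0 2 : EuclideanSpace ℝ (Fin 2)) 0 = 0
      simp
      linarith
    · rintro ⟨y, rfl⟩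
      exact h y.2

/-- In a circle chart and the collar chart extending it, the map is z ↦ (z, 0), the normal form of
an immersion. Local diffeomorphisms are allowed so that the result also serves several circles
mapped to one disc. -/
theorem isImmersionAt_circleToDisc_comp {C : Type*} [TopologicalSpace C]
    [ChartedSpace (EuclideanSpace ℝ (Fin 1)) C] [IsManifold (𝓡 1) ∞ C] {g : C → UnitCircle} {c : C}
    (hg : IsLocalDiffeomorphAt (𝓡 1) (𝓡 1) ∞ g c) :
    Manifold.IsImmersionAtOfComplement ℝ (𝓡 1) (𝓡∂ 2) ∞ (circleToDisc ∘ g) c := by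
  have hcont : ContinuousAt (circleToDisc ∘ g) c :=
    (continuous_inclusion Metric.sphere_subset_closedBall).continuousAt.comp
      hg.contMDiffAt.continuousAt
  obtain ⟨Φ, hc, hΦ⟩ := hg
  let φ := chartAt (EuclideanSpace ℝ (Fin 1)) (g c)
  have hφ : φ ∈ IsManifold.maximalAtlas (𝓡 1) ∞ UnitCircle :=
    IsManifold.chart_mem_maximalAtlas (g c)
  refine Manifold.IsImmersionAtOfComplement.mk_of_continuousAt hcont collarEquiv
    (Φ.toOpenPartialHomeomorph.trans φ) (chartAt (EuclideanHalfSpace 2) (circleToDisc (g c)))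
    ⟨hc, ?_⟩ (mem_chart_source _ _) ?_ (IsManifold.chart_mem_maximalAtlas _) ?_
  · change Φ c ∈ φ.source
    rw [← hΦ hc]
    exact mem_chart_source _ _
  · refine OpenPartialHomeomorph.mem_maximalAtlas_of_contMDiffOn _ ?_ ?_
    · exact (contMDiffOn_of_mem_maximalAtlas hφ).comp
        (Φ.contMDiffOn_toFun.mono fun y hy => hy.1) fun y hy => hy.2
    · exact Φ.contMDiffOn_invFun.comp
        ((contMDiffOn_symm_of_mem_maximalAtlas hφ).mono fun y hy => hy.1) fun y hy => hy.2
  · intro z hz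
    rw [OpenPartialHomeomorph.extend_target] at hz
    obtain ⟨⟨h1, h2⟩, -⟩ := hz
    have h1' : z ∈ φ.target := h1
    have h2' : φ.symm z ∈ Φ.target := h2
    have h3 : g (Φ.invFun (φ.symm z)) = φ.symm z :=
      (hΦ (Φ.map_target h2')).trans (Φ.right_inv h2')
    have h4 : ((discStraighteningChart (circleToDisc (g c))).restrict
        (circleToDisc (φ.symm z))).1 = collarEquiv (z, 0) := by
      rw [discStraighteningChart_circleToDisc]
      refine (StraighteningChart.coe_restrict _
        (mem_collarChart_source (φ.map_target h1'))).trans ?_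
      refine (collarChart_coe φ (φ.symm z)).trans ?_
      rw [φ.right_inv h1']
    rw [← h3] at h4
    exact h4

end Disc

/-! ### Pulling back manifold structures along local homeomorphisms -/

section LocalHomeomorph

variable {𝕜 : Type*} [NontriviallyNormedField 𝕜] {E E' F : Type*} [NormedAddCommGroup E]
  [NormedSpace 𝕜 E] [NormedAddCommGroup E'] [NormedSpace 𝕜 E'] [NormedAddCommGroup F]
  [NormedSpace 𝕜 F] {H H' : Type*} [TopologicalSpace H] [TopologicalSpace H']
  {I : ModelWithCorners 𝕜 E H} {J : ModelWithCorners 𝕜 E' H'}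
  {X Y M : Type*} [TopologicalSpace X] [TopologicalSpace Y]
  [TopologicalSpace M] [ChartedSpace H' M] {f : X → Y} {n : ℕ∞ω}

/-- Even with different local inverses of `f`, the map `f` cancels on the overlap, and the
transition map is a restriction of that of `φ` and `φ'`. -/
theorem StructureGroupoid.trans_mem_of_coe_eq (G : StructureGroupoid H)
    [ClosedUnderRestriction G] {e e' : OpenPartialHomeomorph X Y} (he : ⇑e = f) (he' : ⇑e' = f)
    {φ φ' : OpenPartialHomeomorph Y H} (hφ : φ.symm.trans φ' ∈ G) :
    (e.trans φ).symm.trans (e'.trans φ') ∈ G := by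
  let T := ((e.trans φ).symm.trans (e'.trans φ')).source
  have hT : IsOpen T := ((e.trans φ).symm.trans (e'.trans φ')).open_source
  have key : ∀ z ∈ T, z ∈ φ.target ∧ φ.symm z ∈ φ'.source ∧ f (e.symm (φ.symm z)) = φ.symm z := by
    rintro z ⟨⟨h1, h2⟩, h3, h4⟩
    have h5 : f (e.symm (φ.symm z)) = φ.symm z := by rw [← he]; exact e.right_inv h2
    refine ⟨h1, ?_, h5⟩
    have h4' : e' (e.symm (φ.symm z)) ∈ φ'.source := h4
    rwa [he', h5] at h4'
  refine G.mem_of_eqOnSource (closedUnderRestriction' hφ hT) ⟨?_, fun z hz => ?_⟩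
  · rw [OpenPartialHomeomorph.restr_source, hT.interior_eq]
    have hsub : T ⊆ (φ.symm.trans φ').source := fun z hz => ⟨(key z hz).1, (key z hz).2.1⟩
    exact (inter_eq_right.2 hsub).symm
  · change φ' (e' (e.symm (φ.symm z))) = φ' (φ.symm z)
    rw [he', (key z hz).2.2]

namespace IsLocalHomeomorph

variable [ChartedSpace H Y]

/-- The structure of charted space pulled back by a local homeomorphism. -/
@[reducible]
noncomputable def pullbackChartedSpace (hf : IsLocalHomeomorph f) : ChartedSpace H X where
  atlas := {ψ | ∃ e : OpenPartialHomeomorph X Y, ⇑e = f ∧ ∃ φ ∈ atlas H Y, ψ = e.trans φ}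
  chartAt x := (hf x).choose.trans (chartAt H (f x))
  mem_chart_source x := by
    have h := (hf x).choose_spec
    refine ⟨h.1, ?_⟩
    change (hf x).choose x ∈ (chartAt H (f x)).source
    rw [← h.2]
    exact mem_chart_source H (f x)
  chart_mem_atlas x := ⟨_, (hf x).choose_spec.2.symm, _, chart_mem_atlas H _, rfl⟩

theorem isManifold (hf : IsLocalHomeomorph f) [IsManifold I n Y] :
    letI : ChartedSpace H X := hf.pullbackChartedSpace
    IsManifold I n X := by
  let : ChartedSpace H X := hf.pullbackChartedSpace
  refine IsManifold.mk' (gr := ⟨?_⟩) I n X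
  rintro _ _ ⟨e, he, φ, hφ, rfl⟩ ⟨e', he', φ', hφ', rfl⟩
  exact (contDiffGroupoid n I).trans_mem_of_coe_eq he he' (HasGroupoid.compatible hφ hφ')

theorem trans_mem_maximalAtlas (hf : IsLocalHomeomorph f) [IsManifold I n Y]
    {e : OpenPartialHomeomorph X Y} (he : ⇑e = f) {φ : OpenPartialHomeomorph Y H}
    (hφ : φ ∈ IsManifold.maximalAtlas I n Y) :
    letI : ChartedSpace H X := hf.pullbackChartedSpace
    e.trans φ ∈ IsManifold.maximalAtlas I n X := by
  let : ChartedSpace H X := hf.pullbackChartedSpace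
  rintro _ ⟨e', he', φ', hφ', rfl⟩
  have h := hφ φ' hφ'
  exact ⟨(contDiffGroupoid n I).trans_mem_of_coe_eq he he' h.1,
    (contDiffGroupoid n I).trans_mem_of_coe_eq he' he h.2⟩

theorem mem_boundary_iff (hf : IsLocalHomeomorph f) (x : X) :
    letI : ChartedSpace H X := hf.pullbackChartedSpace
    x ∈ I.boundary X ↔ f x ∈ I.boundary Y := by
  let : ChartedSpace H X := hf.pullbackChartedSpace
  have h : extChartAt I x x = extChartAt I (f x) (f x) := by
    change I (chartAt H (f x) ((hf x).choose x)) = I (chartAt H (f x) (f x))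
    rw [← (hf x).choose_spec.2]
  change extChartAt I x x ∈ frontier (range I) ↔ extChartAt I (f x) (f x) ∈ frontier (range I)
  rw [h]

/-- Read in a pulled-back chart, `ι` has the same coordinate expression as f ∘ ι. -/
theorem isImmersionAt_of_comp (hf : IsLocalHomeomorph f) [IsManifold I n Y] {ι : M → X} {x : M}
    (hι : ContinuousAt ι x) (h : Manifold.IsImmersionAtOfComplement F J I n (f ∘ ι) x) :
    letI : ChartedSpace H X := hf.pullbackChartedSpace
    Manifold.IsImmersionAtOfComplement F J I n ι x := by
  let : ChartedSpace H X := hf.pullbackChartedSpace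
  obtain ⟨e, hxe, he⟩ := hf (ι x)
  refine Manifold.IsImmersionAtOfComplement.mk_of_continuousAt hι h.equiv h.domChart
    (e.trans h.codChart) h.mem_domChart_source ⟨hxe, ?_⟩ h.domChart_mem_maximalAtlas
    (hf.trans_mem_maximalAtlas he.symm h.codChart_mem_maximalAtlas) ?_
  · change e (ι x) ∈ h.codChart.source
    rw [← he]
    exact h.mem_codChart_source
  · have h1 : (e.trans h.codChart).extend I ∘ ι = h.codChart.extend I ∘ (f ∘ ι) :=
      funext fun y => congrArg (fun q => I (h.codChart q)) (congrFun he.symm (ι y))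
    rw [← Function.comp_assoc, h1]
    exact h.writtenInCharts

end IsLocalHomeomorph

/-- Each sheet {p} × Y is open. This gives a disjoint union of copies of the disc its smooth
structure. -/
theorem isLocalHomeomorph_snd_of_discreteTopology (D : Type*) [TopologicalSpace D]
    [DiscreteTopology D] : IsLocalHomeomorph (Prod.snd : D × Y → Y) := fun p =>
  ⟨{ toFun := Prod.snd
     invFun := fun y => (p.1, y)
     source := {p.1} ×ˢ univ
     target := univ
     map_source' := fun _ _ => mem_univ _
     map_target' := fun _ _ => ⟨rfl, mem_univ _⟩
     left_inv' := fun _ hq => Prod.ext hq.1.symm rfl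
     right_inv' := fun _ _ => rfl
     open_source := (isOpen_discrete _).prod isOpen_univ
     open_target := isOpen_univ
     continuousOn_toFun := continuous_snd.continuousOn
     continuousOn_invFun := by fun_prop }, ⟨rfl, mem_univ _⟩, rfl⟩

end LocalHomeomorph

/-! ### Boundaries of discs and cobordism -/

section Cobordism

theorem isSmoothEmbedding_circleToDisc_comp {C : Type*} [TopologicalSpace C]
    [ChartedSpace (EuclideanSpace ℝ (Fin 1)) C] [IsManifold (𝓡 1) ∞ C]
    (Φ : Diffeomorph (𝓡 1) (𝓡 1) C UnitCircle ∞) :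
    Manifold.IsSmoothEmbedding (𝓡 1) (𝓡∂ 2) ∞ (circleToDisc ∘ Φ) :=
  ⟨Manifold.IsImmersionOfComplement.isImmersion (F := ℝ) fun c =>
    isImmersionAt_circleToDisc_comp (Φ.isLocalDiffeomorph c),
    (IsEmbedding.inclusion Metric.sphere_subset_closedBall).comp Φ.toHomeomorph.isEmbedding⟩

theorem everyCircleBoundsDisc : EveryCircleBoundsDisc.{u} :=
  ⟨inferInstance, inferInstance, isSmoothEmbedding_disc_val, fun _ Φ =>
    ⟨isSmoothEmbedding_circleToDisc_comp Φ, (Φ.surjective.range_comp _).trans boundary_disc.symm⟩⟩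

namespace ClosedManifold

/-- The disjoint union of finitely many circles bounds the disjoint union of as many discs. -/
theorem IsFiniteDisjointUnionOfCircles.exists_isBoundaryParametrization
    {M : ClosedManifold.{u} 1} (hM : M.IsFiniteDisjointUnionOfCircles) :
    ∃ (W : Type u) (_ : TopologicalSpace W) (_ : ChartedSpace (EuclideanHalfSpace 2) W),
      T2Space W ∧ CompactSpace W ∧ IsManifold (𝓡∂ 2) ∞ W ∧
        ∃ ι : M → W, IsBoundaryParametrization 1 ι := by
  obtain ⟨k, U, hdisj, hcover, hdiff⟩ := hM
  have hΦ : ∀ i, ∃ _ : Diffeomorph (𝓡 1) (𝓡 1) (U i) UnitCircle ∞, True :=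
    fun i => (hdiff i).elim fun Φ => ⟨Φ, trivial⟩
  choose Φ _ using hΦ
  have hmem : ∀ x : M, ∃ i, x ∈ U i := fun x =>
    TopologicalSpace.Opens.mem_iSup.1 (hcover ▸ TopologicalSpace.Opens.mem_top x)
  choose idx hidx using hmem
  have huniq : ∀ {x : M} {i}, x ∈ U i → idx x = i := fun {x i} hx => by
    by_contra hne
    exact disjoint_left.1 (TopologicalSpace.Opens.coe_disjoint.2 (hdisj hne)) (hidx x) hx
  -- The diffeomorphisms of the pieces glue to one local diffeomorphism to the circle; the locally
  -- constant index `idx` separates the sheets.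
  let g : M → UnitCircle := fun x => Φ (idx x) ⟨x, hidx x⟩
  have hg : ∀ {x : M} {i} (hx : x ∈ U i), g x = Φ i ⟨x, hx⟩ := fun {x i} hx => by
    obtain rfl := huniq hx
    rfl
  have hgloc : IsLocalDiffeomorph (𝓡 1) (𝓡 1) ∞ g := fun x => by
    let i := idx x
    refine ⟨{ toFun := g
              invFun := fun s => ((Φ i).symm s).1
              source := U i
              target := univ
              map_source' := fun _ _ => mem_univ _
              map_target' := fun s _ => ((Φ i).symm s).2
              left_inv' := fun y hy => by rw [hg hy]; simp
              right_inv' := fun s _ => by rw [hg ((Φ i).symm s).2]; simp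
              open_source := (U i).isOpen
              open_target := isOpen_univ
              contMDiffOn_toFun := fun y hy => ?_
              contMDiffOn_invFun := ?_ }, hidx x, fun _ _ => rfl⟩
    · refine ContMDiffAt.contMDiffWithinAt ?_
      refine (contMDiffAt_subtype_iff (U := U i) (x := ⟨y, hy⟩)).1 ?_
      have : (fun z : U i => g z) = Φ i := funext fun z => hg z.2
      rw [this]
      exact (Φ i).contMDiff _
    · exact (contMDiff_subtype_val.comp (Φ i).symm.contMDiff).contMDiffOn
  -- One disc for each circle; the lift places `W` in the universe of `M`.
  let W := ULift.{u} (Fin k) × UnitDisc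
  have hsnd : IsLocalHomeomorph (Prod.snd : W → UnitDisc) :=
    isLocalHomeomorph_snd_of_discreteTopology _
  let : ChartedSpace (EuclideanHalfSpace 2) W := hsnd.pullbackChartedSpace
  let ι : M → W := fun x => (ULift.up (idx x), circleToDisc (g x))
  have hidxc : Continuous fun x => ULift.up.{u} (idx x) := by
    refine continuous_iff_continuousAt.2 fun x => ?_
    refine (continuousAt_const (y := ULift.up (idx x))).congr ?_
    filter_upwards [(U (idx x)).isOpen.mem_nhds (hidx x)] with y hy
    rw [huniq hy]
  have hιc : Continuous ι := hidxc.prodMk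
    ((continuous_inclusion Metric.sphere_subset_closedBall).comp hgloc.contMDiff.continuous)
  have hιinj : Function.Injective ι := fun x y hxy => by
    have h1 : idx x = idx y := congrArg (fun p : W => p.1.down) hxy
    have h2 : g x = g y :=
      inclusion_injective Metric.sphere_subset_closedBall (congrArg Prod.snd hxy)
    have hx : x ∈ U (idx y) := h1 ▸ hidx x
    rw [hg hx, hg (hidx y)] at h2
    exact congrArg Subtype.val ((Φ (idx y)).injective h2)
  have himm : Manifold.IsImmersionOfComplement ℝ (𝓡 1) (𝓡∂ 2) ∞ ι := fun x =>
    hsnd.isImmersionAt_of_comp hιc.continuousAt (isImmersionAt_circleToDisc_comp (hgloc x))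
  have hrange : range ι = (𝓡∂ 2).boundary W := by
    ext w
    have hw : w ∈ (𝓡∂ 2).boundary W ↔ w.2 ∈ (𝓡∂ 2).boundary UnitDisc := hsnd.mem_boundary_iff w
    refine Iff.trans ?_ hw.symm
    rw [boundary_disc]
    constructor
    · rintro ⟨x, rfl⟩
      exact mem_range_self _
    · rintro ⟨s, hs⟩
      let x := (Φ w.1.down).symm s
      refine ⟨x.1, Prod.ext (ULift.ext _ _ (huniq x.2)) ?_⟩
      change circleToDisc (g x.1) = w.2
      rw [hg x.2, ← hs]
      exact congrArg circleToDisc ((Φ w.1.down).apply_symm_apply s)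
  exact ⟨W, inferInstance, inferInstance, inferInstance, inferInstance, hsnd.isManifold, ι,
    ⟨himm.isImmersion, (hιc.isClosedEmbedding hιinj).isEmbedding⟩, hrange⟩

/-- The disjoint union of two closed manifolds. -/
noncomputable def sum {n : ℕ} (M N : ClosedManifold.{u} n) : ClosedManifold.{u} n where
  carrier := M ⊕ N

/-- The disjoint union of `M` and `N` is itself a closed 1-manifold, so it is a boundary. -/
theorem cobordant_of_dim_one (M N : ClosedManifold.{u} 1) : Cobordant M N :=
  (M.sum N).isFiniteDisjointUnionOfCircles.exists_isBoundaryParametrization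

end ClosedManifold

end Cobordism

theorem mainTheorem6 :
    (∀ M : ClosedManifold.{u} 1, M.IsFiniteDisjointUnionOfCircles) ∧
    EveryCircleBoundsDisc.{u} ∧
    (∀ M : ClosedManifold.{u} 1, M.Nullbordant) ∧
    (∃ h : Equivalence (ClosedManifold.Cobordant (n := 1) : ClosedManifold.{u} 1 → _ → Prop),
      Nat.card (Quotient (Setoid.mk _ h)) = 1) := by
  have hall := ClosedManifold.cobordant_of_dim_one.{u}
  refine ⟨fun M => M.isFiniteDisjointUnionOfCircles, everyCircleBoundsDisc,
    fun M => hall M _, ⟨fun _ => hall _ _, fun _ => hall _ _, fun _ _ => hall _ _⟩, ?_⟩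
  -- Cobordism relates any two manifolds, so there is at most one class; the empty manifold provides
  -- one.
  rw [Nat.card_eq_one_iff_unique]
  exact ⟨⟨Quotient.ind₂ fun M N => Quotient.sound (hall M N)⟩, ⟨Quotient.mk _ (.empty 1)⟩⟩
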